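/- **Consistency of the parametric GNAR spectrum estimator.** Let $G=(K,E)$ be a finite undirected graph with $d\ge 1$ nodes and graph distance $\delta$, let $\mathbf W=(w_{ij})\in\mathbb R^{d\times d}$ be a weight matrix, and for $r\ge1$ let $\mathbf A_r\in\{0,1\}^{d\times d}$ be the $r$-stage adjacency matrix, $[\mathbf A_r]_{ij}=1$ iff $\delta(i,j)=r$. Let $p,s_1,\dots,s_p$ be known orders such that $\mathbf W\odot\mathbf A_r\neq 0$ whenever $1\le r\le s_k$ for some $k$. Let $\{\mathbf X_t\}_{t\in\mathbb Z}$ be a weakly stationary $\mathbb R^d$-valued GNAR$(p,[s_1,\dots,s_p])$ process, $$\mathbf X_t=\sum_{k=1}^p\Big(\alpha_k\mathbf X_{t-k}+\sum_{r=1}^{s_k}\beta_{kr}(\mathbf W\odot\mathbf A_r)\mathbf X_{t-k}\Big)+\mathbf u_t ,\qquad \alpha_k,\beta_{kr}\in\mathbb R,$$ where the innovations $\mathbf u_t$ are i.i.d. random vectors with finite second moments, mean zero and positive definite covariance matrix $\mathbf V_d$, and $\mathbf u_t$ is independent of the past $\{\mathbf X_\tau\}_{\tau<t}$. For $\omega\in(0,0.5]$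 put $$\mathbf U_p(\omega)=\mathbb I_d-\sum_{k=1}^p\Big[\alpha_k\mathbb I_d+\sum_{r=1}^{s_k}\beta_{kr}(\mathbf W\odot\mathbf A_r)\Big]e^{-i2\pi k\omega},\qquad \mathbf f_{\rm GNAR}(\omega)=\mathbf U_p^{-1}(\omega)\,\mathbf V_d\,\big(\mathbf U_p^{-1}(\omega)\big)^{H},$$ $\mathbf S_{\rm GNAR}=\mathbf f_{\rm GNAR}^{-1}$, and define the squared coherence and squared partial coherence $$[\rho_{\rm GNAR}]_{ij}^2=\frac{|[\mathbf f_{\rm GNAR}]_{ij}|^2}{[\mathbf f_{\rm GNAR}]_{ii}[\mathbf f_{\rm GNAR}]_{jj}},\qquad [\gamma_{\rm GNAR}]_{ij}^2=\frac{|[\mathbf S_{\rm GNAR}]_{ij}|^2}{[\mathbf S_{\rm GNAR}]_{ii}[\mathbf S_{\rm GNAR}]_{jj}} .$$ From the observations $\mathbf X_1,\dots,\mathbf X_T$ let $\widehat\beta=(\mathbb X^\top\mathbb X)^{-1}\mathbb X^\top\mathbb Y$ be the ordinary least-squares estimator of the coefficient vector $(\alpha_k,\beta_{kr})$, where $\mathbb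 Y$ stacks $\mathbf X_t$ and $\mathbb X$ stacks the matrices with columns $\mathbf X_{t-k}$ and $(\mathbf W\odot\mathbf A_r)\mathbf X_{t-k}$ ($1\le k\le p$, $1\le r\le s_k$), for $t=p+1,\dots,T$; let $\widehat{\mathbf u}_t$ be the residuals and $\widehat{\mathbf V}_d=\frac1{T-p}\sum_{t=p+1}^T\widehat{\mathbf u}_t\widehat{\mathbf u}_t^\top$. Let $\widehat{\mathbf U}_p(\omega)$ be $\mathbf U_p(\omega)$ with the coefficients replaced by $\widehat\beta$, $\widehat{\mathbf f}_{\rm GNAR}(\omega)=\widehat{\mathbf U}_p^{-1}(\omega)\widehat{\mathbf V}_d(\widehat{\mathbf U}_p^{-1}(\omega))^H$, $\widehat{\mathbf S}_{\rm GNAR}=\widehat{\mathbf f}_{\rm GNAR}^{-1}$, and let $\widehat\rho^{\,2}_{\rm GNAR}$, $\widehat\gamma^{\,2}_{\rm GNAR}$ be the corresponding squared coherence and squared partial coherence. Then for every $\omega\in(0,0.5]$ the matrices $\mathbf U_p(\omega)$ and $\mathbf f_{\rm GNAR}(\omega)$ are invertible; with probability tending to one as $T\to\infty$ the matrices $\mathbb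 X^\top\mathbb X$, $\widehat{\mathbf U}_p(\omega)$ and $\widehat{\mathbf f}_{\rm GNAR}(\omega)$ are invertible, so that all the estimators are defined; and, as $T\to\infty$, entrywise, $$\widehat{\mathbf f}_{\rm GNAR}(\omega)\xrightarrow{p}\mathbf f_{\rm GNAR}(\omega),\quad \widehat{\mathbf S}_{\rm GNAR}(\omega)\xrightarrow{p}\mathbf S_{\rm GNAR}(\omega),\quad [\widehat\rho_{\rm GNAR}(\omega)]^2_{ij}\xrightarrow{p}[\rho_{\rm GNAR}(\omega)]^2_{ij},\quad [\widehat\gamma_{\rm GNAR}(\omega)]^2_{ij}\xrightarrow{p}[\gamma_{\rm GNAR}(\omega)]^2_{ij}.$$ -/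

import Mathlib

open MeasureTheory ProbabilityTheory Filter Topology

noncomputable section

namespace GNAR

variable {K : Type*} {Ω : Type*} [MeasurableSpace Ω] {p : ℕ}

/-- The `r`-stage adjacency matrix of `G` (for `r ≥ 1`): it has a `1` exactly at the pairs of nodes
at graph distance `r`. (Unreachable pairs have `G.dist = 0`, so they never count.) -/
def stageAdj (G : SimpleGraph K) (r : ℕ) : Matrix K K ℝ :=
  Matrix.of fun i j => if 1 ≤ r ∧ G.dist i j = r then 1 else 0

/-- The matrix `W ⊙ A_r` of the `r`-stage neighbourhood regression. -/
def nbhdMatrix (G : SimpleGraph K) (W : Matrix K K ℝ) (r : ℕ) : Matrix K K ℝ :=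
  Matrix.hadamard W (stageAdj G r)

/-- Index set of the `q = p + ∑ₖ sₖ` coefficients of a GNAR`(p, [s₁, …, s_p])` model. With
`k : Fin p` standing for lag `k + 1` and `r : Fin (s k)` for stage `r + 1`, the index `Sum.inl k`
is that of `α_{k+1}` and `Sum.inr ⟨k, r⟩` is that of `β_{k+1,r+1}`. -/
abbrev CoefIndex (s : Fin p → ℕ) : Type := Fin p ⊕ (Σ k : Fin p, Fin (s k))

variable [Fintype K]

/-- `Z^r = (W ⊙ A_r) x`, the `r`-stage neighbourhood vector of `x`. -/
def nbhdVec (G : SimpleGraph K) (W : Matrix K K ℝ) (r : ℕ) (x : K → ℝ) : K → ℝ :=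
  (nbhdMatrix G W r).mulVec x

/-- The regressor with index `c` in the regression for node `i` at time `t`: `X_{i,t-k}` for the
coefficient `α_k` and `Z^r_{i,t-k}` for the coefficient `β_{kr}`. -/
def regressor (G : SimpleGraph K) (W : Matrix K K ℝ) (s : Fin p → ℕ) (x : ℤ → K → ℝ)
    (t : ℤ) (i : K) : CoefIndex s → ℝ
  | Sum.inl k => x (t - ((k : ℕ) + 1)) i
  | Sum.inr ⟨k, r⟩ => nbhdVec G W ((r : ℕ) + 1) (x (t - ((k : ℕ) + 1))) i

/-- Weak (second-order) stationarity of a vector-valued time series. -/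
structure IsWeaklyStationary (μ : Measure Ω) (X : ℤ → Ω → K → ℝ) : Prop where
  measurable : ∀ t, Measurable (X t)
  memLp : ∀ t i, MemLp (fun x => X t x i) 2 μ
  mean_eq : ∀ t i, ∫ x, X t x i ∂μ = ∫ x, X 0 x i ∂μ
  cov_eq : ∀ t h i j, covariance (fun x => X (t + h) x i) (fun x => X t x j) μ
    = covariance (fun x => X h x i) (fun x => X 0 x j) μ

/-- `u` is an i.i.d. sequence of square-integrable random vectors with mean zero and covariance
matrix `V`. -/
structure IsIIDNoise (μ : Measure Ω) (V : Matrix K K ℝ) (u : ℤ → Ω → K → ℝ) : Prop where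
  measurable : ∀ t, Measurable (u t)
  indep : iIndepFun u μ
  identDistrib : ∀ t, IdentDistrib (u t) (u 0) μ μ
  memLp : ∀ t i, MemLp (fun x => u t x i) 2 μ
  mean_zero : ∀ t i, ∫ x, u t x i ∂μ = 0
  cov_eq : ∀ t i j, covariance (fun x => u t x i) (fun x => u t x j) μ = V i j

/-- `X` is a stationary GNAR`(p, [s₁, …, s_p])` process on the network `G` with weights `W`,
coefficients `θ = (α, β)` and innovations `u` with covariance matrix `V`. That the `u t` are
innovations means that `u t` is independent of the past `(X τ)_{τ < t}`. -/
structure IsStationaryGNAR (μ : Measure Ω) (G : SimpleGraph K) (W : Matrix K K ℝ) (s : Fin p → ℕ)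
    (θ : CoefIndex s → ℝ) (V : Matrix K K ℝ) (X u : ℤ → Ω → K → ℝ) : Prop where
  stationary : IsWeaklyStationary μ X
  noise : IsIIDNoise μ V u
  innovation : ∀ t : ℤ, IndepFun (u t) (fun x (τ : Set.Iio t) => X (τ : ℤ) x) μ
  equation : ∀ t : ℤ, ∀ᵐ x ∂μ, ∀ i : K,
    X t x i = ∑ k : Fin p, (θ (Sum.inl k) * X (t - ((k : ℕ) + 1)) x i
      + ∑ r : Fin (s k), θ (Sum.inr ⟨k, r⟩)
          * nbhdVec G W ((r : ℕ) + 1) (X (t - ((k : ℕ) + 1)) x) i) + u t x i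

/-- The stacked response vector: row `(τ, i)` is node `i` at time `t = p + 1 + τ`, where
`τ = 0, …, T - p - 1`, so that `t` runs over `p + 1, …, T`. -/
def response (p : ℕ) (x : ℤ → K → ℝ) (T : ℕ) : Fin (T - p) × K → ℝ :=
  fun a => x ((p : ℤ) + 1 + (a.1 : ℕ)) a.2

/-- The stacked `(T - p)d × q` design matrix, with rows as in `response`. -/
def design (G : SimpleGraph K) (W : Matrix K K ℝ) (s : Fin p → ℕ) (x : ℤ → K → ℝ) (T : ℕ) :
    Matrix (Fin (T - p) × K) (CoefIndex s) ℝ :=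
  Matrix.of fun a => regressor G W s x ((p : ℤ) + 1 + (a.1 : ℕ)) a.2

/-- The Gram matrix `𝕏ᵀ𝕏`. -/
def gram (G : SimpleGraph K) (W : Matrix K K ℝ) (s : Fin p → ℕ) (x : ℤ → K → ℝ) (T : ℕ) :
    Matrix (CoefIndex s) (CoefIndex s) ℝ :=
  (design G W s x T).transpose * design G W s x T

/-- The least-squares estimator `(𝕏ᵀ𝕏)⁻¹ 𝕏ᵀ 𝕐` computed from the observations
`x 1, …, x T`. -/
def coefEst (G : SimpleGraph K) (W : Matrix K K ℝ) (s : Fin p → ℕ) (x : ℤ → K → ℝ) (T : ℕ) :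
    CoefIndex s → ℝ :=
  (gram G W s x T)⁻¹.mulVec ((design G W s x T).transpose.mulVec (response p x T))

/-- The stacked residual vector `𝕐 - 𝕏 β̂`. -/
def residual (G : SimpleGraph K) (W : Matrix K K ℝ) (s : Fin p → ℕ) (x : ℤ → K → ℝ) (T : ℕ) :
    Fin (T - p) × K → ℝ :=
  response p x T - (design G W s x T).mulVec (coefEst G W s x T)

/-- The residual covariance estimator `(T - p)⁻¹ ∑ₜ û_t û_tᵀ`. -/
def covEst (G : SimpleGraph K) (W : Matrix K K ℝ) (s : Fin p → ℕ) (x : ℤ → K → ℝ) (T : ℕ) :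
    Matrix K K ℝ :=
  Matrix.of fun i j => (((T - p : ℕ) : ℝ))⁻¹
    * ∑ τ : Fin (T - p), residual G W s x T (τ, i) * residual G W s x T (τ, j)

variable [DecidableEq K]

/-- The vector-autoregressive coefficient matrix
`Φ_k = α_k I + ∑_{r=1}^{s_k} β_{kr} (W ⊙ A_r)` at lag `k + 1`. -/
def arMatrix (G : SimpleGraph K) (W : Matrix K K ℝ) (s : Fin p → ℕ) (θ : CoefIndex s → ℝ)
    (k : Fin p) : Matrix K K ℝ :=
  θ (Sum.inl k) • (1 : Matrix K K ℝ)
    + ∑ r : Fin (s k), θ (Sum.inr ⟨k, r⟩) • nbhdMatrix G W ((r : ℕ) + 1)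

/-- `U_p(ω) = I - ∑_{k=1}^p Φ_k e^{-2πikω}`. -/
def transfer (G : SimpleGraph K) (W : Matrix K K ℝ) (s : Fin p → ℕ) (θ : CoefIndex s → ℝ)
    (ω : ℝ) : Matrix K K ℂ :=
  1 - ∑ k : Fin p, Complex.exp (-(Complex.I * 2 * Real.pi * ((k : ℕ) + 1) * ω))
    • (arMatrix G W s θ k).map Complex.ofReal

/-- The GNAR spectrum `U_p(ω)⁻¹ V (U_p(ω)⁻¹)ᴴ` with coefficients `θ` and innovation
covariance `V`. -/
def spectrum (G : SimpleGraph K) (W : Matrix K K ℝ) (s : Fin p → ℕ) (θ : CoefIndex s → ℝ)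
    (V : Matrix K K ℝ) (ω : ℝ) : Matrix K K ℂ :=
  (transfer G W s θ ω)⁻¹ * V.map Complex.ofReal * ((transfer G W s θ ω)⁻¹).conjTranspose

/-- The plug-in estimator of the GNAR spectrum from the observations `x 1, …, x T`. -/
def spectrumEst (G : SimpleGraph K) (W : Matrix K K ℝ) (s : Fin p → ℕ) (x : ℤ → K → ℝ) (T : ℕ)
    (ω : ℝ) : Matrix K K ℂ :=
  spectrum G W s (coefEst G W s x T) (covEst G W s x T) ω

/-- `|M_{ij}|² / (M_{ii} M_{jj})` for a Hermitian matrix `M` (whose diagonal is real): the squared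
coherence if `M` is a spectrum, the squared partial coherence if `M` is an inverse spectrum. -/
def sqCoherence {K : Type*} (M : Matrix K K ℂ) (i j : K) : ℝ :=
  ‖M i j‖ ^ 2 / ((M i i).re * (M j j).re)

/-- All inverses in the plug-in estimators at `ω` from `x 1, …, x T` exist. -/
def EstimatorsDefined (G : SimpleGraph K) (W : Matrix K K ℝ) (s : Fin p → ℕ) (x : ℤ → K → ℝ)
    (T : ℕ) (ω : ℝ) : Prop :=
  IsUnit (gram G W s x T).det ∧ IsUnit (transfer G W s (coefEst G W s x T) ω).det ∧
    IsUnit (spectrumEst G W s x T ω).det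

end GNAR

end

/-!
The process is put into state space form: the state `Y t` collects `X t, …, X (t - p + 1)` and
satisfies `Y (t + 1) = B Y t + H u (t + 1)` with the block companion matrix `B` and the block column
`H` that inserts a vector at lag zero.

*Stability.* The innovation `u (t + 1)` is orthogonal to `Y t`, so by stationarity the second moment
`Γ` of the state solves the Lyapunov equation `Γ = B Γ Bᵀ + H V Hᵀ` (`stateMoment_lyapunov`). Along
an orbit of `Bᵀ` the quadratic form of `Γ` therefore drops at each step by the quadratic form of `V`
at the lag-zero block. As `V` is positive definite and `Bᵀ` shifts each block to the front, this
makes `Γ` positive definite (`lyapunov_posDef`) and the powers of `B` tend to zero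
(`tendsto_companion_pow`). A kernel vector `w` of `U_p(ω)` would give the eigenvector
`(w, z w, z² w, …)` of `B` with an eigenvalue of modulus one, so `U_p(ω)` is invertible
(`transfer_kernel_eq_zero`), and this holds at every real frequency `ω`.

*Laws of large numbers.* The sample second moment of the innovations converges by the strong law,
and the sample cross moment of `Y t` and `u (t + 1)` tends to zero in mean square, because its
summands are orthogonal (`tendstoProb_crossAverage`). Summing outer products in the recursion shows
that the sample second moment `S` of the state satisfies `S - B S Bᵀ = H V Hᵀ + o_P(1)`. The map
`M ↦ M - B M Bᵀ` is injective since `B` is stable, hence has a continuous left inverse, and `S`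
converges in probability to `Γ` (`tendstoProb_stateAverage`). No ergodic theorem and no
moving-average representation is needed.

*Plug-in.* The normalised Gram matrix, the least-squares estimator and the residual covariance are
explicit functions of these three sample moments, continuous at their limits because the limiting
Gram matrix is positive definite (`gramMap_posDef`): `Γ` is, and `I` and the nonzero matrices
`W ⊙ A_r` have disjoint supports. This yields joint consistency (`tendstoProb_estimators`). The
spectrum, its inverse and both coherences are continuous functions of the coefficients and the
innovation covariance near the true values, and invertibility is an open condition.
-/

noncomputable section

namespace GNAR

/-! ### Convergence in probability to a constant -/

section TendstoProb

variable {Ω ι : Type*} [MeasurableSpace Ω] {μ : Measure Ω} {l : Filter ι}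

/-- `f n` converges in probability to the constant `c`: every neighbourhood of `c` contains `f n`
with probability tending to one. Unlike `TendstoInMeasure` this needs only a topology on the target,
so it applies to matrices, which carry no canonical metric. -/
def TendstoProb {E : Type*} [TopologicalSpace E] (μ : Measure Ω) (f : ι → Ω → E) (l : Filter ι)
    (c : E) : Prop :=
  ∀ U ∈ 𝓝 c, Tendsto (fun n => μ {x | f n x ∉ U}) l (𝓝 0)

theorem TendstoProb.comp_continuousAt {E F : Type*} [TopologicalSpace E] [TopologicalSpace F]
    {f : ι → Ω → E} {c : E} (h : TendstoProb μ f l c) {g : E → F} (hg : ContinuousAt g c) :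
    TendstoProb μ (fun n x => g (f n x)) l (g c) :=
  fun _ hU => h _ (hg hU)

theorem TendstoProb.congr' {E : Type*} [TopologicalSpace E] {f f' : ι → Ω → E} {c : E}
    (h : TendstoProb μ f l c) (hff : ∀ᶠ n in l, ∀ᵐ x ∂μ, f n x = f' n x) :
    TendstoProb μ f' l c := by
  intro U hU
  refine (h U hU).congr' ?_
  filter_upwards [hff] with n hn
  refine measure_congr ?_
  filter_upwards [hn] with x hx
  change (f n x ∉ U) = (f' n x ∉ U)
  rw [hx]

theorem TendstoProb.comp_tendsto {E κ : Type*} [TopologicalSpace E] {f : ι → Ω → E} {c : E}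
    (h : TendstoProb μ f l c) {l' : Filter κ} {φ : κ → ι} (hφ : Tendsto φ l' l) :
    TendstoProb μ (fun n => f (φ n)) l' c :=
  fun U hU => (h U hU).comp hφ

theorem TendstoProb.prodMk {E F : Type*} [TopologicalSpace E] [TopologicalSpace F]
    {f : ι → Ω → E} {g : ι → Ω → F} {c : E} {d : F}
    (hf : TendstoProb μ f l c) (hg : TendstoProb μ g l d) :
    TendstoProb μ (fun n x => (f n x, g n x)) l (c, d) := by
  intro U hU
  obtain ⟨A, hA, B, hB, hAB⟩ := mem_nhds_prod_iff.1 hU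
  have h := (hf A hA).add (hg B hB)
  rw [add_zero] at h
  refine tendsto_of_tendsto_of_tendsto_of_le_of_le tendsto_const_nhds h (fun _ => zero_le) ?_
  intro n
  refine (measure_mono ?_).trans (measure_union_le _ _)
  intro x hx
  by_contra hcon
  simp only [Set.mem_union, Set.mem_ofPred_eq, not_or, not_not] at hcon
  exact hx (hAB ⟨hcon.1, hcon.2⟩)

theorem TendstoProb.pi {κ : Type*} [Finite κ] {E : κ → Type*} [∀ k, TopologicalSpace (E k)]
    {f : ι → Ω → ∀ k, E k} {c : ∀ k, E k}
    (h : ∀ k, TendstoProb μ (fun n x => f n x k) l (c k)) : TendstoProb μ f l c := by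
  cases nonempty_fintype κ
  intro U hU
  rw [nhds_pi, Filter.mem_pi'] at hU
  obtain ⟨I, t, ht, hsub⟩ := hU
  have hs := tendsto_finsetSum (Finset.univ : Finset κ) (fun k _ => h k (t k) (ht k))
  rw [Finset.sum_const_zero] at hs
  refine tendsto_of_tendsto_of_tendsto_of_le_of_le tendsto_const_nhds hs (fun _ => zero_le) ?_
  intro n
  refine (measure_mono ?_).trans (measure_biUnion_finset_le Finset.univ _)
  intro x hx
  by_contra hcon
  simp only [Set.mem_iUnion, Set.mem_ofPred_eq, not_exists, not_not, Finset.mem_univ] at hcon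
  exact hx (hsub fun k _ => hcon k trivial)

theorem TendstoProb.matrix {m n E : Type*} [Finite m] [Finite n] [TopologicalSpace E]
    {f : ι → Ω → Matrix m n E} {c : Matrix m n E}
    (h : ∀ i j, TendstoProb μ (fun k x => f k x i j) l (c i j)) : TendstoProb μ f l c :=
  TendstoProb.pi fun i => TendstoProb.pi fun j => h i j

theorem TendstoProb.add {E : Type*} [TopologicalSpace E] [Add E] [ContinuousAdd E]
    {f g : ι → Ω → E} {c d : E}
    (hf : TendstoProb μ f l c) (hg : TendstoProb μ g l d) :
    TendstoProb μ (fun n x => f n x + g n x) l (c + d) :=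
  (hf.prodMk hg).comp_continuousAt (g := fun q : E × E => q.1 + q.2) continuous_add.continuousAt

theorem TendstoProb.tendstoInMeasure {E : Type*} [PseudoEMetricSpace E] {f : ι → Ω → E} {c : E}
    (h : TendstoProb μ f l c) : TendstoInMeasure μ f l (fun _ => c) := by
  intro ε hε
  refine (h _ (Metric.eball_mem_nhds c hε)).congr fun n => ?_
  congr 1
  ext x
  simp

theorem _root_.MeasureTheory.TendstoInMeasure.tendstoProb {E : Type*} [PseudoEMetricSpace E]
    {f : ι → Ω → E} {c : E}
    (h : TendstoInMeasure μ f l (fun _ => c)) : TendstoProb μ f l c := by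
  intro U hU
  obtain ⟨ε, hε, hsub⟩ := EMetric.mem_nhds_iff.1 hU
  refine tendsto_of_tendsto_of_tendsto_of_le_of_le tendsto_const_nhds (h ε hε)
    (fun _ => zero_le) fun n => measure_mono ?_
  intro x hx
  by_contra hcon
  exact hx (hsub (Metric.mem_eball.2 (not_le.1 hcon)))

/-- Markov's inequality, as a criterion for convergence in probability to zero. -/
theorem tendstoProb_zero_of_integral_abs {f : ι → Ω → ℝ} (hf : ∀ n, Integrable (f n) μ)
    (h : Tendsto (fun n => ∫ x, |f n x| ∂μ) l (𝓝 0)) : TendstoProb μ f l 0 := by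
  refine TendstoInMeasure.tendstoProb (tendstoInMeasure_of_tendsto_eLpNorm (p := 1) one_ne_zero
    (fun n => (hf n).aestronglyMeasurable) aestronglyMeasurable_const ?_)
  have h' := ENNReal.tendsto_ofReal h
  rw [ENNReal.ofReal_zero] at h'
  refine h'.congr fun n => ?_
  rw [eLpNorm_one_eq_lintegral_enorm,
    ofReal_integral_eq_lintegral_ofReal (hf n).abs (ae_of_all _ fun x => abs_nonneg _)]
  refine lintegral_congr fun x => ?_
  simp [Real.enorm_eq_ofReal_abs]

/-- Chebyshev's inequality, as a criterion for convergence in probability to zero. -/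
theorem tendstoProb_zero_of_integral_sq [IsFiniteMeasure μ] {f : ι → Ω → ℝ}
    (hf : ∀ n, MemLp (f n) 2 μ)
    (h : Tendsto (fun n => ∫ x, f n x ^ 2 ∂μ) l (𝓝 0)) : TendstoProb μ f l 0 := by
  have hsq : TendstoProb μ (fun n x => f n x ^ 2) l 0 := by
    refine tendstoProb_zero_of_integral_abs (fun n => (hf n).integrable_sq) ?_
    simpa only [abs_pow, sq_abs] using h
  have habs := hsq.comp_continuousAt (g := Real.sqrt) Real.continuous_sqrt.continuousAt
  intro U hU
  obtain ⟨ε, hε, hsub⟩ := Metric.mem_nhds_iff.1 hU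
  refine tendsto_of_tendsto_of_tendsto_of_le_of_le tendsto_const_nhds
    (habs (Metric.ball (Real.sqrt 0) ε) (Metric.ball_mem_nhds _ hε))
    (fun _ => zero_le) fun n => measure_mono ?_
  intro x hx hcon
  refine hx (hsub ?_)
  simpa [Real.sqrt_sq_eq_abs] using hcon

/-- Weak law of large numbers for orthogonal variables with bounded second moments. -/
theorem tendstoProb_average_of_orthogonal [IsFiniteMeasure μ] {ξ : ℕ → Ω → ℝ} {M : ℝ}
    (hξ : ∀ n, MemLp (ξ n) 2 μ) (hM : ∀ n, ∫ x, ξ n x ^ 2 ∂μ ≤ M)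
    (horth : ∀ m n, m < n → ∫ x, ξ m x * ξ n x ∂μ = 0) :
    TendstoProb μ (fun (n : ℕ) x => (n : ℝ)⁻¹ * ∑ i ∈ Finset.range n, ξ i x) atTop 0 := by
  have horth' : ∀ m n, m ≠ n → ∫ x, ξ m x * ξ n x ∂μ = 0 := by
    intro m n hmn
    rcases lt_or_gt_of_ne hmn with h | h
    · exact horth m n h
    · rw [← horth n m h]
      exact integral_congr_ae (ae_of_all _ fun x => mul_comm _ _)
  have hsumLp : ∀ n, MemLp (fun x => ∑ i ∈ Finset.range n, ξ i x) 2 μ := fun n =>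
    memLp_finsetSum _ fun i _ => hξ i
  have hint : ∀ m n, Integrable (fun x => ξ m x * ξ n x) μ := fun m n =>
    (hξ m).integrable_mul (hξ n)
  have hsum : ∀ n, ∫ x, (∑ i ∈ Finset.range n, ξ i x) ^ 2 ∂μ ≤ n * M := by
    intro n
    have : ∫ x, (∑ i ∈ Finset.range n, ξ i x) ^ 2 ∂μ
        = ∑ i ∈ Finset.range n, ∫ x, ξ i x ^ 2 ∂μ := by
      simp only [sq, Finset.sum_mul_sum]
      rw [integral_finsetSum _ fun i _ => integrable_finsetSum _ fun j _ => hint i j]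
      refine Finset.sum_congr rfl fun i hi => ?_
      rw [integral_finsetSum _ fun j _ => hint i j]
      exact Finset.sum_eq_single_of_mem i hi fun j _ hj => horth' i j hj.symm
    rw [this]
    refine (Finset.sum_le_sum fun i _ => hM i).trans ?_
    simp
  refine tendstoProb_zero_of_integral_sq (fun n => (hsumLp n).const_mul _) ?_
  refine tendsto_of_tendsto_of_tendsto_of_le_of_le (g := fun _ => (0 : ℝ))
    (h := fun n : ℕ => M * (n : ℝ)⁻¹) tendsto_const_nhds ?_
    (fun n => integral_nonneg fun x => sq_nonneg _) ?_
  · simpa using tendsto_inv_atTop_nhds_zero_nat.const_mul M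
  · intro n
    simp only [mul_pow]
    rw [integral_const_mul]
    rcases Nat.eq_zero_or_pos n with rfl | hn
    · simp
    have hn' : (0 : ℝ) < n := by exact_mod_cast hn
    calc ((n : ℝ)⁻¹) ^ 2 * ∫ x, (∑ i ∈ Finset.range n, ξ i x) ^ 2 ∂μ
        ≤ ((n : ℝ)⁻¹) ^ 2 * (n * M) := by gcongr; exact hsum n
      _ = M * (n : ℝ)⁻¹ := by field_simp

end TendstoProb

/-! ### Companion matrices and the Lyapunov equation -/

section Companion

open Matrix

variable {K : Type*} [Fintype K] [DecidableEq K] {p : ℕ}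

/-- The block companion matrix of the vector autoregression with lag matrices `Φ 0, …, Φ (p - 1)`
(`Φ k` belongs to lag `k + 1`). The first block row is `Φ`, and below it identity blocks shift every
lag to the next one. It acts on states indexed by lag and node. -/
def companion {R : Type*} [Semiring R] (Φ : Fin p → Matrix K K R) :
    Matrix (Fin p × K) (Fin p × K) R :=
  Matrix.of fun a b => (if a.1.val = 0 then Φ b.1 a.2 b.2 else 0)
    + (if a.1.val = b.1.val + 1 ∧ a.2 = b.2 then 1 else 0)

/-- The block column that inserts a vector as the lag-zero block of a state. -/
def headMatrix (p : ℕ) (K : Type*) [DecidableEq K] : Matrix (Fin p × K) K ℝ :=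
  Matrix.of fun a j => if a.1.val = 0 ∧ a.2 = j then 1 else 0

theorem companion_mulVec {R : Type*} [CommSemiring R] (Φ : Fin p → Matrix K K R)
    (v : Fin p × K → R) (a : Fin p × K) :
    (companion Φ *ᵥ v) a = (if a.1.val = 0 then ∑ l, (Φ l *ᵥ fun j => v (l, j)) a.2 else 0)
      + ∑ l : Fin p, if a.1.val = l.val + 1 then v (l, a.2) else 0 := by
  simp only [Matrix.mulVec, dotProduct, companion, Matrix.of_apply, add_mul, ite_mul, zero_mul,
    one_mul, Fintype.sum_prod_type, Finset.sum_add_distrib]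
  congr 1
  · split_ifs <;> simp
  · refine Finset.sum_congr rfl fun l _ => ?_
    by_cases h : a.1.val = l.val + 1 <;> simp [h]

theorem companion_transpose_mulVec (Φ : Fin p → Matrix K K ℝ) (v : Fin p × K → ℝ)
    (l : Fin p) (j : K) :
    ((companion Φ)ᵀ *ᵥ v) (l, j) = ((Φ l)ᵀ *ᵥ ((headMatrix p K)ᵀ *ᵥ v)) j
      + ∑ k : Fin p, if k.val = l.val + 1 then v (k, j) else 0 := by
  simp only [Matrix.mulVec, dotProduct, companion, headMatrix, Matrix.of_apply,
    Matrix.transpose_apply, add_mul, ite_mul, zero_mul,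
    one_mul, Fintype.sum_prod_type, Finset.sum_add_distrib]
  congr 1
  · rw [Finset.sum_comm]
    refine Finset.sum_congr rfl fun i _ => ?_
    rw [Finset.mul_sum]
    refine Finset.sum_congr rfl fun k _ => ?_
    by_cases hk : k.val = 0 <;> simp [hk]
  · refine Finset.sum_congr rfl fun k _ => ?_
    by_cases h : k.val = l.val + 1 <;> simp [h]

theorem headMatrix_mulVec (u : K → ℝ) (a : Fin p × K) :
    (headMatrix p K *ᵥ u) a = if a.1.val = 0 then u a.2 else 0 := by
  simp [headMatrix, Matrix.mulVec, dotProduct, ite_and]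

theorem headMatrix_transpose_mulVec (v : Fin p × K → ℝ) {k : Fin p} (hk : k.val = 0) (i : K) :
    ((headMatrix p K)ᵀ *ᵥ v) i = v (k, i) := by
  simp only [Matrix.mulVec, dotProduct, headMatrix, Matrix.of_apply,
    Matrix.transpose_apply, ite_mul, zero_mul, one_mul, Fintype.sum_prod_type]
  rw [Finset.sum_eq_single k]
  · simp [hk]
  · intro l _ hl
    have : l.val ≠ 0 := fun h => hl (Fin.ext (h.trans hk.symm))
    simp [this]
  · simp

theorem companion_transpose_mulVec_of_lt (Φ : Fin p → Matrix K K ℝ) (v : Fin p × K → ℝ)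
    {l k : Fin p} (hk : k.val = l.val + 1) (j : K) :
    ((companion Φ)ᵀ *ᵥ v) (l, j)
      = ((Φ l)ᵀ *ᵥ ((headMatrix p K)ᵀ *ᵥ v)) j + v (k, j) := by
  rw [companion_transpose_mulVec]
  congr 1
  rw [Finset.sum_eq_single k]
  · simp [hk]
  · intro m _ hm
    exact if_neg fun h => hm (Fin.ext (h.trans hk.symm))
  · simp

theorem companion_transpose_mulVec_of_eq (Φ : Fin p → Matrix K K ℝ) (v : Fin p × K → ℝ)
    {l : Fin p} (hl : l.val + 1 = p) (j : K) :
    ((companion Φ)ᵀ *ᵥ v) (l, j) = ((Φ l)ᵀ *ᵥ ((headMatrix p K)ᵀ *ᵥ v)) j := by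
  rw [companion_transpose_mulVec, Finset.sum_eq_zero, add_zero]
  intro k _
  exact if_neg fun h => by have := k.isLt; omega

variable {Φ : Fin p → Matrix K K ℝ} {V : Matrix K K ℝ} {Γ : Matrix (Fin p × K) (Fin p × K) ℝ}

/-- Along the orbit of the transposed companion matrix the quadratic form of a solution of the
Lyapunov equation drops by the innovation quadratic form of the head. -/
theorem lyapunov_quadratic
    (hΓ : Γ = companion Φ * Γ * (companion Φ)ᵀ + headMatrix p K * V * (headMatrix p K)ᵀ)
    (v : Fin p × K → ℝ) :
    v ⬝ᵥ (Γ *ᵥ v) = ((companion Φ)ᵀ *ᵥ v) ⬝ᵥ (Γ *ᵥ ((companion Φ)ᵀ *ᵥ v))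
      + ((headMatrix p K)ᵀ *ᵥ v) ⬝ᵥ (V *ᵥ ((headMatrix p K)ᵀ *ᵥ v)) := by
  have key : ∀ {m : Type _} [Fintype m] (A : Matrix (Fin p × K) m ℝ) (M : Matrix m m ℝ),
      v ⬝ᵥ ((A * M * Aᵀ) *ᵥ v) = (Aᵀ *ᵥ v) ⬝ᵥ (M *ᵥ (Aᵀ *ᵥ v)) := by
    intro m _ A M
    rw [← Matrix.mulVec_mulVec, ← Matrix.mulVec_mulVec, Matrix.dotProduct_mulVec v A,
      ← Matrix.mulVec_transpose]
  conv_lhs => rw [hΓ]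
  rw [Matrix.add_mulVec, dotProduct_add, key, key]

theorem pow_succ_mulVec' {n : Type*} [Fintype n] [DecidableEq n] (A : Matrix n n ℝ) (j : ℕ)
    (v : n → ℝ) : A ^ (j + 1) *ᵥ v = A *ᵥ (A ^ j *ᵥ v) := by
  rw [pow_succ', Matrix.mulVec_mulVec]

/-- Observability: the only state whose orbit has vanishing quadratic form is zero, because the
transposed companion matrix shifts every block in turn into the head. -/
theorem lyapunov_posDef (hV : V.PosDef) (hpsd : Γ.PosSemidef)
    (hΓ : Γ = companion Φ * Γ * (companion Φ)ᵀ + headMatrix p K * V * (headMatrix p K)ᵀ) :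
    Γ.PosDef := by
  refine Matrix.PosDef.of_dotProduct_mulVec_pos hpsd.1 fun v hv => ?_
  have hnn : ∀ w, 0 ≤ w ⬝ᵥ (Γ *ᵥ w) := fun w => by
    simpa using hpsd.dotProduct_mulVec_nonneg w
  have hVnn : ∀ w, 0 ≤ w ⬝ᵥ (V *ᵥ w) := fun w => by
    simpa using hV.posSemidef.dotProduct_mulVec_nonneg w
  rw [star_trivial]
  refine lt_of_le_of_ne (hnn v) fun h0 => hv ?_
  set x : ℕ → Fin p × K → ℝ := fun j => ((companion Φ)ᵀ ^ j) *ᵥ v with hx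
  have hstep : ∀ j, x (j + 1) = (companion Φ)ᵀ *ᵥ x j := fun j => pow_succ_mulVec' _ _ _
  have hq : ∀ j, x j ⬝ᵥ (Γ *ᵥ x j) = 0 := by
    intro j
    induction j with
    | zero => simpa [hx] using h0.symm
    | succ j ih =>
      have := lyapunov_quadratic hΓ (x j)
      rw [ih, ← hstep] at this
      linarith [hnn (x (j + 1)), hVnn ((headMatrix p K)ᵀ *ᵥ x j)]
  have hhead : ∀ j, (headMatrix p K)ᵀ *ᵥ x j = 0 := by
    intro j
    by_contra hne
    have hpos := hV.dotProduct_mulVec_pos hne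
    rw [star_trivial] at hpos
    have := lyapunov_quadratic hΓ (x j)
    rw [hq, ← hstep, hq] at this
    linarith
  -- as the heads vanish, block `m` of a state is the head of the state `m` steps later
  have hall : ∀ m j (k : Fin p) i, k.val = m → x j (k, i) = 0 := by
    intro m
    induction m with
    | zero =>
      intro j k i hk
      rw [← headMatrix_transpose_mulVec (x j) hk i, hhead, Pi.zero_apply]
    | succ m ih =>
      intro j k i hk
      have h1 := companion_transpose_mulVec_of_lt Φ (x j) (l := ⟨m, by omega⟩) (k := k) hk i
      rw [hhead, Matrix.mulVec_zero, Pi.zero_apply, zero_add, ← hstep] at h1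
      rw [← h1]
      exact ih _ _ _ rfl
  funext a
  have := hall a.1.val 0 a.1 a.2 rfl
  simpa [hx] using this

open scoped MatrixOrder Matrix.Norms.L2Operator in
/-- This factorisation turns the quadratic form of `V` into a sum of squares. -/
theorem exists_transpose_mul_self_of_posDef (hV : V.PosDef) :
    ∃ L : Matrix K K ℝ, V = Lᵀ * L ∧ IsUnit L.det := by
  obtain ⟨L, hL⟩ := CStarAlgebra.nonneg_iff_eq_star_mul_self.mp hV.posSemidef.nonneg
  have hVdet : IsUnit V.det := (Matrix.isUnit_iff_isUnit_det _).1 hV.isUnit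
  rw [Matrix.star_eq_conjTranspose, Matrix.conjTranspose_eq_transpose_of_trivial] at hL
  refine ⟨L, hL, ?_⟩
  rw [hL, Matrix.det_mul] at hVdet
  exact isUnit_of_mul_isUnit_right hVdet

theorem tendsto_zero_of_quadratic (hV : V.PosDef) {h : ℕ → K → ℝ}
    (hh : Tendsto (fun j => h j ⬝ᵥ (V *ᵥ h j)) atTop (𝓝 0)) : Tendsto h atTop (𝓝 0) := by
  obtain ⟨L, hL, hLdet⟩ := exists_transpose_mul_self_of_posDef hV
  have hquad : ∀ w : K → ℝ, w ⬝ᵥ (V *ᵥ w) = ∑ i, (L *ᵥ w) i ^ 2 := by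
    intro w
    rw [hL, ← Matrix.mulVec_mulVec,
      Matrix.dotProduct_mulVec, ← Matrix.mulVec_transpose, Matrix.transpose_transpose]
    simp [dotProduct, sq]
  have hLh : Tendsto (fun j => L *ᵥ h j) atTop (𝓝 0) := by
    rw [tendsto_pi_nhds]
    intro i
    have hsq : Tendsto (fun j => (L *ᵥ h j) i ^ 2) atTop (𝓝 0) := by
      refine tendsto_of_tendsto_of_tendsto_of_le_of_le tendsto_const_nhds hh
        (fun j => sq_nonneg _) fun j => ?_
      simp only [hquad]
      exact Finset.single_le_sum (f := fun i => (L *ᵥ h j) i ^ 2)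
        (fun i _ => sq_nonneg _) (Finset.mem_univ i)
    have := (Real.continuous_sqrt.tendsto 0).comp hsq
    rw [Real.sqrt_zero] at this
    refine (tendsto_zero_iff_abs_tendsto_zero _).2 (this.congr fun j => ?_)
    simp [Real.sqrt_sq_eq_abs]
  have hcont : Continuous fun w : K → ℝ => L⁻¹ *ᵥ w := by fun_prop
  have := (hcont.tendsto 0).comp hLh
  rw [Matrix.mulVec_zero] at this
  refine this.congr fun j => ?_
  simp [Matrix.nonsing_inv_mul L hLdet]

/-- Stability: the total drop of the quadratic form along an orbit is finite, so the heads tend to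
zero; the other blocks follow, starting from the last lag. -/
theorem tendsto_companion_transpose_pow_mulVec (hV : V.PosDef) (hpsd : Γ.PosSemidef)
    (hΓ : Γ = companion Φ * Γ * (companion Φ)ᵀ + headMatrix p K * V * (headMatrix p K)ᵀ)
    (v : Fin p × K → ℝ) :
    Tendsto (fun j => ((companion Φ)ᵀ ^ j) *ᵥ v) atTop (𝓝 0) := by
  have hnn : ∀ w, 0 ≤ w ⬝ᵥ (Γ *ᵥ w) := fun w => by
    simpa using hpsd.dotProduct_mulVec_nonneg w
  have hVnn : ∀ w, 0 ≤ w ⬝ᵥ (V *ᵥ w) := fun w => by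
    simpa using hV.posSemidef.dotProduct_mulVec_nonneg w
  set x : ℕ → Fin p × K → ℝ := fun j => ((companion Φ)ᵀ ^ j) *ᵥ v with hx
  have hstep : ∀ j, x (j + 1) = (companion Φ)ᵀ *ᵥ x j := fun j => pow_succ_mulVec' _ _ _
  have hdrop : ∀ j, ((headMatrix p K)ᵀ *ᵥ x j) ⬝ᵥ (V *ᵥ ((headMatrix p K)ᵀ *ᵥ x j))
      = x j ⬝ᵥ (Γ *ᵥ x j) - x (j + 1) ⬝ᵥ (Γ *ᵥ x (j + 1)) := by
    intro j
    have := lyapunov_quadratic hΓ (x j)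
    rw [← hstep] at this
    linarith
  have hanti : Antitone fun j => x j ⬝ᵥ (Γ *ᵥ x j) := by
    refine antitone_nat_of_succ_le fun j => ?_
    linarith [hdrop j, hVnn ((headMatrix p K)ᵀ *ᵥ x j)]
  have hlim := tendsto_atTop_ciInf hanti ⟨0, by rintro _ ⟨j, rfl⟩; exact hnn _⟩
  have hhead : Tendsto (fun j => (headMatrix p K)ᵀ *ᵥ x j) atTop (𝓝 0) := by
    refine tendsto_zero_of_quadratic hV ?_
    simp only [hdrop]
    simpa using hlim.sub (hlim.comp (tendsto_add_atTop_nat 1))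
  have hΦ : ∀ (l : Fin p) (j : K),
      Tendsto (fun n => ((Φ l)ᵀ *ᵥ ((headMatrix p K)ᵀ *ᵥ x n)) j) atTop (𝓝 0) := by
    intro l j
    have hc : Continuous fun w : K → ℝ => ((Φ l)ᵀ *ᵥ w) j := by fun_prop
    have h := (hc.tendsto 0).comp hhead
    rwa [Matrix.mulVec_zero, Pi.zero_apply] at h
  -- induction from the last lag `k + 1 = p` downwards
  have hall : ∀ m (k : Fin p) (i : K), k.val + 1 + m = p →
      Tendsto (fun n => x n (k, i)) atTop (𝓝 0) := by
    intro m
    induction m with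
    | zero =>
      intro k i hk
      rw [← tendsto_add_atTop_iff_nat 1]
      refine (hΦ k i).congr fun n => ?_
      rw [hstep, companion_transpose_mulVec_of_eq Φ (x n) hk]
    | succ m ih =>
      intro k i hk
      rw [← tendsto_add_atTop_iff_nat 1]
      have hk' : k.val + 1 < p := by omega
      have h2 := (hΦ k i).add (ih ⟨k.val + 1, hk'⟩ i (by simp only; omega))
      rw [add_zero] at h2
      refine h2.congr fun n => ?_
      rw [hstep, companion_transpose_mulVec_of_lt Φ (x n) (k := ⟨k.val + 1, hk'⟩) rfl]
  rw [tendsto_pi_nhds]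
  intro a
  exact hall (p - (a.1.val + 1)) a.1 a.2 (by have := a.1.isLt; omega)

theorem tendsto_companion_transpose_pow (hV : V.PosDef) (hpsd : Γ.PosSemidef)
    (hΓ : Γ = companion Φ * Γ * (companion Φ)ᵀ + headMatrix p K * V * (headMatrix p K)ᵀ) :
    Tendsto (fun j => (companion Φ)ᵀ ^ j) atTop (𝓝 0) := by
  refine tendsto_pi_nhds.2 fun a => tendsto_pi_nhds.2 fun b => ?_
  have := tendsto_pi_nhds.1
    (tendsto_companion_transpose_pow_mulVec hV hpsd hΓ (Pi.single b 1)) a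
  simpa using this

theorem tendsto_companion_pow (hV : V.PosDef) (hpsd : Γ.PosSemidef)
    (hΓ : Γ = companion Φ * Γ * (companion Φ)ᵀ + headMatrix p K * V * (headMatrix p K)ᵀ) :
    Tendsto (fun j => companion Φ ^ j) atTop (𝓝 0) := by
  have hc : Continuous fun M : Matrix (Fin p × K) (Fin p × K) ℝ => Mᵀ :=
    continuous_id.matrix_transpose
  have := (hc.tendsto 0).comp (tendsto_companion_transpose_pow hV hpsd hΓ)
  rw [Matrix.transpose_zero] at this
  refine this.congr fun j => ?_
  simp [Matrix.transpose_pow]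

/-- A stable matrix `B` admits no nonzero solution of the homogeneous equation `M = B M Bᵀ`, so
`M` depends continuously on `M - B M Bᵀ`. -/
theorem exists_continuous_leftInverse_lyapunov {n : Type*} [Fintype n] [DecidableEq n]
    {B : Matrix n n ℝ}
    (hB : Tendsto (fun j => B ^ j) atTop (𝓝 0)) :
    ∃ g : Matrix n n ℝ → Matrix n n ℝ, Continuous g ∧ ∀ M, g (M - B * M * Bᵀ) = M := by
  let L : Matrix n n ℝ →ₗ[ℝ] Matrix n n ℝ :=
    { toFun := fun M => M - B * M * Bᵀ
      map_add' := fun M N => by simp only [Matrix.mul_add, Matrix.add_mul]; abel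
      map_smul' := fun c M => by simp [smul_sub] }
  have hker : LinearMap.ker L = ⊥ := by
    refine LinearMap.ker_eq_bot'.2 fun M hM => ?_
    -- a solution of the homogeneous equation is invariant under all powers, which tend to zero
    have hM' : M = B * M * Bᵀ := sub_eq_zero.1 hM
    have hpow : ∀ j, M = B ^ j * M * (B ^ j)ᵀ := by
      intro j
      induction j with
      | zero => simp
      | succ j ih =>
        conv_lhs => rw [hM', ih]
        simp only [pow_succ', Matrix.transpose_mul, Matrix.mul_assoc]
    have hc : Continuous fun A : Matrix n n ℝ => A * M * Aᵀ := by fun_prop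
    have hlim := (hc.tendsto 0).comp hB
    simp only [Matrix.zero_mul] at hlim
    exact tendsto_nhds_unique (tendsto_const_nhds.congr fun j => hpow j) hlim
  obtain ⟨g, hg⟩ := L.exists_leftInverse_of_injective hker
  exact ⟨g, g.continuous_of_finiteDimensional, fun M => LinearMap.congr_fun hg M⟩

/-- A vector in the kernel of `1 - ∑ₖ zᵏ⁺¹ Φ k` with `|z| = 1` yields the eigenvector
`(w, z w, z² w, …)` of the companion matrix with eigenvalue `z⁻¹`, whose orbit has constant norm. -/
theorem transfer_kernel_eq_zero (hB : Tendsto (fun j => companion Φ ^ j) atTop (𝓝 0))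
    {z : ℂ} (hz : ‖z‖ = 1) {w : K → ℂ}
    (hw : (1 - ∑ k : Fin p, z ^ (k.val + 1) • (Φ k).map Complex.ofReal) *ᵥ w = 0) : w = 0 := by
  have hz0 : z ≠ 0 := norm_ne_zero_iff.1 (by rw [hz]; exact one_ne_zero)
  set Ψ : Fin p → Matrix K K ℂ := fun k => (Φ k).map Complex.ofReal with hΨ
  have hw' : ∀ i, w i = ∑ k : Fin p, z ^ (k.val + 1) * (Ψ k *ᵥ w) i := by
    intro i
    have := congrFun hw i
    rw [Matrix.sub_mulVec, Matrix.one_mulVec, Matrix.sum_mulVec, Pi.sub_apply, Pi.zero_apply,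
      sub_eq_zero, Finset.sum_apply] at this
    simpa [Matrix.smul_mulVec] using this
  set v : Fin p × K → ℂ := fun a => z ^ a.1.val * w a.2 with hv
  have hblock : ∀ l : Fin p, (fun j => v (l, j)) = z ^ l.val • w := fun l => rfl
  have heig : companion Ψ *ᵥ v = z⁻¹ • v := by
    funext a
    rw [companion_mulVec]
    by_cases ha : a.1.val = 0
    · rw [if_pos ha, Finset.sum_eq_zero fun l _ => if_neg (by omega), add_zero, Pi.smul_apply,
        smul_eq_mul, hv]
      simp only [ha, pow_zero, one_mul]
      rw [hw' a.2, Finset.mul_sum]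
      refine Finset.sum_congr rfl fun l _ => ?_
      rw [hblock, Matrix.mulVec_smul, Pi.smul_apply, smul_eq_mul, pow_succ]
      field_simp
    · rw [if_neg ha, zero_add, Finset.sum_eq_single (⟨a.1.val - 1, by omega⟩ : Fin p)]
      · rw [if_pos (by simp only; omega), Pi.smul_apply, smul_eq_mul, hv]
        simp only
        obtain ⟨m, hm⟩ := Nat.exists_eq_succ_of_ne_zero ha
        rw [hm, Nat.succ_eq_add_one, Nat.add_sub_cancel, pow_succ]
        field_simp
      · intro l _ hl
        exact if_neg fun h => hl (Fin.ext (by simp only; omega))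
      · simp
  have hpow : ∀ j : ℕ, (companion Ψ ^ j) *ᵥ v = (z⁻¹) ^ j • v := by
    intro j
    induction j with
    | zero => simp
    | succ j ih =>
      rw [pow_succ', ← Matrix.mulVec_mulVec, ih, Matrix.mulVec_smul, heig, smul_smul, pow_succ]
  have hmap : companion Ψ = (companion Φ).map Complex.ofRealHom := by
    ext a b
    simp only [companion, hΨ, Matrix.of_apply, Matrix.map_apply, map_add]
    congr 1 <;> split_ifs <;> simp
  have hlim : Tendsto (fun j => (companion Ψ ^ j) *ᵥ v) atTop (𝓝 0) := by
    have hc : Continuous fun M : Matrix (Fin p × K) (Fin p × K) ℝ =>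
        M.map Complex.ofRealHom *ᵥ v :=
      (continuous_id.matrix_map Complex.continuous_ofReal).matrix_mulVec continuous_const
    have h := (hc.tendsto 0).comp hB
    rw [Matrix.map_zero _ (map_zero _), Matrix.zero_mulVec] at h
    refine h.congr fun j => ?_
    simp only [Function.comp_apply]
    rw [hmap]
    congr 1
    exact Matrix.map_pow (companion Φ) Complex.ofRealHom j
  have hv0 : v = 0 := by
    funext a
    have h := (tendsto_pi_nhds.1 hlim a).norm
    rw [Pi.zero_apply, norm_zero] at h
    have hconst : ∀ j : ℕ, ‖((companion Ψ ^ j) *ᵥ v) a‖ = ‖v a‖ := by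
      intro j
      simp [hpow, hz]
    simp only [hconst] at h
    exact norm_eq_zero.1 (tendsto_nhds_unique tendsto_const_nhds h)
  funext i
  rw [hw' i, Pi.zero_apply]
  refine Finset.sum_eq_zero fun k _ => ?_
  have hk : z ^ k.val • (Ψ k *ᵥ w) = 0 := by
    rw [← Matrix.mulVec_smul, ← hblock, hv0]
    exact Matrix.mulVec_zero _
  have := congrFun hk i
  simp only [Pi.smul_apply, smul_eq_mul, Pi.zero_apply] at this
  rw [pow_succ, mul_right_comm, this, zero_mul]

end Companion

/-! ### State space form of a GNAR process -/

section StateSpace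

open Matrix

variable {K : Type*} {p : ℕ}

/-- The state at time `t`: the values at the times `t, t - 1, …, t - p + 1`, indexed by delay and
node. -/
def state (p : ℕ) (x : ℤ → K → ℝ) (t : ℤ) : Fin p × K → ℝ :=
  fun a => x (t - (a.1.val : ℤ)) a.2

theorem state_pred (x : ℤ → K → ℝ) (t : ℤ) (k : Fin p) :
    (fun j => state p x (t - 1) (k, j)) = x (t - ((k : ℕ) + 1)) := by
  funext j
  simp only [state]
  congr 1
  ring

theorem measurable_state (t : ℤ) (a : Fin p × K) :
    Measurable fun x : ℤ → K → ℝ => state p x t a :=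
  (measurable_pi_apply a.2).comp (measurable_pi_apply _)

theorem state_congr {x y : ℤ → K → ℝ} {t t' : ℤ} (h : ∀ τ < t, x τ = y τ) (ht : t' < t) :
    state p x t' = state p y t' := by
  funext a
  simp only [state]
  rw [h _ (by omega)]

variable [Fintype K] [DecidableEq K]

/-- The block row `(Φ₁, …, Φ_p)` of autoregressive coefficient matrices. It sends the state at time
`t - 1` to the one-step prediction of the value at time `t`. -/
def arRow (G : SimpleGraph K) (W : Matrix K K ℝ) (s : Fin p → ℕ) (θ : CoefIndex s → ℝ) :
    Matrix K (Fin p × K) ℝ :=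
  Matrix.of fun i a => arMatrix G W s θ a.1 i a.2

theorem arRow_mulVec (G : SimpleGraph K) (W : Matrix K K ℝ) (s : Fin p → ℕ)
    (θ : CoefIndex s → ℝ) (v : Fin p × K → ℝ) (i : K) :
    (arRow G W s θ *ᵥ v) i = ∑ k, (arMatrix G W s θ k *ᵥ fun j => v (k, j)) i := by
  simp [arRow, Matrix.mulVec, dotProduct, Fintype.sum_prod_type]

theorem arMatrix_mulVec (G : SimpleGraph K) (W : Matrix K K ℝ) (s : Fin p → ℕ)
    (θ : CoefIndex s → ℝ) (k : Fin p) (v : K → ℝ) (i : K) :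
    (arMatrix G W s θ k *ᵥ v) i = θ (Sum.inl k) * v i
      + ∑ r : Fin (s k), θ (Sum.inr ⟨k, r⟩) * nbhdVec G W ((r : ℕ) + 1) v i := by
  simp [arMatrix, nbhdVec, Matrix.add_mulVec, Matrix.sum_mulVec, Matrix.smul_mulVec]

theorem arRow_mulVec_state (G : SimpleGraph K) (W : Matrix K K ℝ) (s : Fin p → ℕ)
    (θ : CoefIndex s → ℝ) (x : ℤ → K → ℝ) (t : ℤ) (i : K) :
    (arRow G W s θ *ᵥ state p x (t - 1)) i
      = ∑ k : Fin p, (θ (Sum.inl k) * x (t - ((k : ℕ) + 1)) i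
        + ∑ r : Fin (s k), θ (Sum.inr ⟨k, r⟩)
          * nbhdVec G W ((r : ℕ) + 1) (x (t - ((k : ℕ) + 1))) i) := by
  simp only [arRow_mulVec, state_pred, arMatrix_mulVec]

theorem sum_mul_regressor (G : SimpleGraph K) (W : Matrix K K ℝ) (s : Fin p → ℕ)
    (θ : CoefIndex s → ℝ) (x : ℤ → K → ℝ) (t : ℤ) (i : K) :
    ∑ c, regressor G W s x t i c * θ c = (arRow G W s θ *ᵥ state p x (t - 1)) i := by
  rw [arRow_mulVec_state, Fintype.sum_sum_type, Fintype.sum_sigma, ← Finset.sum_add_distrib]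
  simp only [regressor, mul_comm (θ _)]

/-- The state of a path that solves the GNAR equation follows a first-order recursion. -/
theorem state_succ {G : SimpleGraph K} {W : Matrix K K ℝ} {s : Fin p → ℕ}
    {θ : CoefIndex s → ℝ} {x u : ℤ → K → ℝ}
    (h : ∀ t, x t = arRow G W s θ *ᵥ state p x (t - 1) + u t) (t : ℤ) :
    state p x (t + 1)
      = companion (arMatrix G W s θ) *ᵥ state p x t + headMatrix p K *ᵥ u (t + 1) := by
  funext a
  rw [Pi.add_apply, companion_mulVec, headMatrix_mulVec]
  by_cases ha : a.1.val = 0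
  · rw [if_pos ha, if_pos ha, Finset.sum_eq_zero fun l _ => if_neg (by omega), add_zero,
      ← arRow_mulVec]
    have := congrFun (h (t + 1)) a.2
    rw [add_sub_cancel_right, Pi.add_apply] at this
    rw [← this]
    simp [state, ha]
  · rw [if_neg ha, if_neg ha, zero_add, add_zero,
      Finset.sum_eq_single (⟨a.1.val - 1, by omega⟩ : Fin p)]
    · rw [if_pos (by simp only; omega)]
      simp only [state]
      congr 1
      omega
    · intro l _ hl
      exact if_neg fun h => hl (Fin.ext (by simp only; omega))
    · simp

/-- One step of the recursion `y' = B y + H u` for outer products. -/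
theorem vecMulVec_affine {l m n : Type*} [Fintype l] [Fintype m] (B : Matrix n l ℝ)
    (H : Matrix n m ℝ) (y : l → ℝ) (u : m → ℝ) :
    vecMulVec (B *ᵥ y + H *ᵥ u) (B *ᵥ y + H *ᵥ u)
      = B * vecMulVec y y * Bᵀ + (B * vecMulVec y u * Hᵀ + (B * vecMulVec y u * Hᵀ)ᵀ
        + H * vecMulVec u u * Hᵀ) := by
  simp only [Matrix.mul_vecMulVec, Matrix.vecMulVec_mul, Matrix.vecMul_transpose,
    Matrix.transpose_vecMulVec, Matrix.add_vecMulVec, Matrix.vecMulVec_add]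
  abel

end StateSpace

/-! ### Moments of a stationary GNAR process -/

section Moments

open Matrix

variable {K : Type*} {Ω : Type*} [MeasurableSpace Ω] {μ : Measure Ω}
  {G : SimpleGraph K} {W : Matrix K K ℝ} {p : ℕ} {s : Fin p → ℕ}
  {θ : CoefIndex s → ℝ} {V : Matrix K K ℝ} {X u : ℤ → Ω → K → ℝ}

/-- The second-moment matrix of the state at time zero. -/
def stateMoment (p : ℕ) (μ : Measure Ω) (X : ℤ → Ω → K → ℝ) :
    Matrix (Fin p × K) (Fin p × K) ℝ :=
  Matrix.of fun a b => ∫ x, state p (fun t => X t x) 0 a * state p (fun t => X t x) 0 b ∂μ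

theorem memLp_state (h : IsWeaklyStationary μ X) (t : ℤ) (a : Fin p × K) :
    MemLp (fun x => state p (fun t => X t x) t a) 2 μ :=
  h.memLp _ _

theorem integral_state_mul_state [IsProbabilityMeasure μ] (h : IsWeaklyStationary μ X) (t : ℤ)
    (a b : Fin p × K) :
    ∫ x, state p (fun t => X t x) t a * state p (fun t => X t x) t b ∂μ
      = stateMoment p μ X a b := by
  have key : ∀ t : ℤ, ∫ x, state p (fun t => X t x) t a * state p (fun t => X t x) t b ∂μ
      = covariance (fun x => X ((b.1.val : ℤ) - a.1.val) x a.2) (fun x => X 0 x b.2) μ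
        + (∫ x, X 0 x a.2 ∂μ) * ∫ x, X 0 x b.2 ∂μ := by
    intro t
    rw [← h.cov_eq (t - b.1.val) _ _ _,
      covariance_eq_sub (h.memLp _ _) (h.memLp _ _), h.mean_eq (t - b.1.val + _),
      h.mean_eq (t - b.1.val),
      sub_add_cancel]
    have : t - (b.1.val : ℤ) + ((b.1.val : ℤ) - a.1.val) = t - a.1.val := by ring
    rw [this]
    rfl
  rw [key t, stateMoment, Matrix.of_apply, key 0]

variable [Fintype K]

/-- The independence of `u t` from the past, for functions of the whole path that depend only on the
times before `t`. -/
theorem indepFun_past (hX : IsStationaryGNAR μ G W s θ V X u) {t : ℤ}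
    {F : (ℤ → K → ℝ) → ℝ} (hF : Measurable F)
    (hFt : ∀ x y : ℤ → K → ℝ, (∀ τ < t, x τ = y τ) → F x = F y) :
    IndepFun (u t) (fun x => F fun τ => X τ x) μ := by
  let ext : (Set.Iio t → K → ℝ) → ℤ → K → ℝ :=
    fun f τ => if h : τ < t then f ⟨τ, h⟩ else 0
  have hext : Measurable ext := by
    refine measurable_pi_lambda _ fun τ => ?_
    by_cases h : τ < t
    · simpa [ext, h] using measurable_pi_apply _
    · simp [ext, h]
  have := (hX.innovation t).comp measurable_id (hF.comp hext)
  refine this.congr (ae_of_all _ fun x => rfl) (ae_of_all _ fun x => ?_)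
  refine hFt _ _ fun τ hτ => ?_
  simp [ext, hτ]

/-- Innovations are orthogonal to every function of the past. -/
theorem integral_past_mul_innovation (hX : IsStationaryGNAR μ G W s θ V X u) {t : ℤ}
    {F : (ℤ → K → ℝ) → ℝ} (hF : Measurable F)
    (hFt : ∀ x y : ℤ → K → ℝ, (∀ τ < t, x τ = y τ) → F x = F y) (j : K) :
    ∫ x, F (fun τ => X τ x) * u t x j ∂μ = 0 := by
  have hind := ((indepFun_past hX hF hFt).comp (measurable_pi_apply j) measurable_id).symm
  have hmeas : Measurable fun x => F fun τ => X τ x :=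
    hF.comp (measurable_pi_lambda _ hX.stationary.measurable)
  have := hind.integral_fun_mul_eq_mul_integral hmeas.aestronglyMeasurable
    ((measurable_pi_apply j).comp (hX.noise.measurable t)).aestronglyMeasurable
  simp only [Function.comp_apply, id] at this
  rw [this, hX.noise.mean_zero, mul_zero]

theorem indepFun_state_sq_innovation_sq (hX : IsStationaryGNAR μ G W s θ V X u) (t : ℤ)
    (a : Fin p × K) (j : K) :
    IndepFun (fun x => state p (fun t => X t x) t a ^ 2) (fun x => u (t + 1) x j ^ 2) μ :=
  ((indepFun_past hX (F := fun x => state p x t a ^ 2) ((measurable_state t a).pow_const 2)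
    (fun x y h => by rw [state_congr h (by omega)])).comp
      (φ := fun w : K → ℝ => w j ^ 2) ((measurable_pi_apply j).pow_const 2) measurable_id).symm

theorem stateMoment_posSemidef (hX : IsStationaryGNAR μ G W s θ V X u) :
    (stateMoment p μ X).PosSemidef := by
  refine Matrix.PosSemidef.of_dotProduct_mulVec_nonneg ?_ fun v => ?_
  · ext a b
    simp only [stateMoment, Matrix.conjTranspose_apply, Matrix.of_apply, star_trivial]
    simp only [mul_comm]
  · have hint : ∀ a b, Integrable (fun x => state p (fun t => X t x) 0 a
        * state p (fun t => X t x) 0 b) μ := fun a b =>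
      (memLp_state hX.stationary 0 a).integrable_mul (memLp_state hX.stationary 0 b)
    have : star v ⬝ᵥ (stateMoment p μ X *ᵥ v)
        = ∫ x, (∑ a, v a * state p (fun t => X t x) 0 a) ^ 2 ∂μ := by
      have hsq : ∀ x, (∑ a, v a * state p (fun t => X t x) 0 a) ^ 2
          = ∑ a, ∑ b, v a * state p (fun t => X t x) 0 a
            * (v b * state p (fun t => X t x) 0 b) := fun x => by rw [sq, Finset.sum_mul_sum]
      simp only [hsq, dotProduct, Matrix.mulVec, stateMoment, Matrix.of_apply,
        star_trivial, Finset.mul_sum]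
      have hint' : ∀ a b, Integrable (fun x => v a * state p (fun t => X t x) 0 a
        * (v b * state p (fun t => X t x) 0 b)) μ := fun a b => by
        refine ((hint a b).const_mul (v a * v b)).congr (ae_of_all _ fun x => ?_)
        simp only
        ring
      rw [integral_finsetSum _ fun a _ => integrable_finsetSum _ fun b _ => hint' a b]
      refine Finset.sum_congr rfl fun a _ => ?_
      rw [integral_finsetSum _ fun b _ => hint' a b]
      refine Finset.sum_congr rfl fun b _ => ?_
      rw [← integral_mul_const, ← integral_const_mul]
      refine integral_congr_ae (ae_of_all _ fun x => ?_)
      simp only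
      ring
    rw [this]
    exact integral_nonneg fun x => sq_nonneg _

theorem integral_innovation_mul_innovation [IsProbabilityMeasure μ]
    (hX : IsStationaryGNAR μ G W s θ V X u) (t : ℤ) (i j : K) :
    ∫ x, u t x i * u t x j ∂μ = V i j := by
  have := hX.noise.cov_eq t i j
  rw [covariance_eq_sub (hX.noise.memLp t i) (hX.noise.memLp t j), hX.noise.mean_zero,
    zero_mul, sub_zero] at this
  exact this

theorem integral_state_mul_innovation (hX : IsStationaryGNAR μ G W s θ V X u) (t : ℤ)
    (a : Fin p × K) (j : K) :
    ∫ x, state p (fun t => X t x) t a * u (t + 1) x j ∂μ = 0 :=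
  integral_past_mul_innovation hX (measurable_state t a)
    (fun x y h => by rw [state_congr h (by omega)]) j

/-- The product of two square-integrable variables is square-integrable here because the factors are
independent; no fourth moments are assumed. -/
theorem memLp_state_mul_innovation (hX : IsStationaryGNAR μ G W s θ V X u) (t : ℤ)
    (a : Fin p × K) (j : K) :
    MemLp (fun x => state p (fun t => X t x) t a * u (t + 1) x j) 2 μ := by
  have hm : AEStronglyMeasurable (fun x => state p (fun t => X t x) t a * u (t + 1) x j) μ :=
    (memLp_state hX.stationary t a).1.mul (hX.noise.memLp (t + 1) j).1
  rw [memLp_two_iff_integrable_sq hm]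
  simp only [mul_pow]
  exact (indepFun_state_sq_innovation_sq hX t a j).integrable_mul
    (memLp_state hX.stationary t a).integrable_sq (hX.noise.memLp (t + 1) j).integrable_sq

theorem integral_sq_state_mul_innovation [IsProbabilityMeasure μ]
    (hX : IsStationaryGNAR μ G W s θ V X u) (t : ℤ) (a : Fin p × K) (j : K) :
    ∫ x, (state p (fun t => X t x) t a * u (t + 1) x j) ^ 2 ∂μ
      = stateMoment p μ X a a * V j j := by
  simp only [mul_pow]
  rw [(indepFun_state_sq_innovation_sq hX t a j).integral_fun_mul_eq_mul_integral
    (memLp_state hX.stationary t a).integrable_sq.1 (hX.noise.memLp (t + 1) j).integrable_sq.1]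
  simp only [sq]
  rw [integral_state_mul_state hX.stationary, integral_innovation_mul_innovation hX]

variable [DecidableEq K]

theorem ae_equation (hX : IsStationaryGNAR μ G W s θ V X u) :
    ∀ᵐ x ∂μ, ∀ t : ℤ,
      X t x = arRow G W s θ *ᵥ state p (fun t => X t x) (t - 1) + u t x := by
  rw [ae_all_iff]
  intro t
  filter_upwards [hX.equation t] with x hx
  funext i
  rw [Pi.add_apply, arRow_mulVec_state, hx i]

/-- The products of a past state and an innovation are orthogonal at different times. The earlier
innovation is a function of the observations up to its own time, by the defining equation. -/
theorem integral_state_mul_innovation_orthogonal (hX : IsStationaryGNAR μ G W s θ V X u)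
    {t t' : ℤ} (htt : t < t') (a : Fin p × K) (j : K) :
    ∫ x, (state p (fun t => X t x) t a * u (t + 1) x j)
      * (state p (fun t => X t x) t' a * u (t' + 1) x j) ∂μ = 0 := by
  let F : (ℤ → K → ℝ) → ℝ := fun x =>
    state p x t a * (x (t + 1) j - (arRow G W s θ *ᵥ state p x t) j) * state p x t' a
  have hF : Measurable F := by
    have h1 : Measurable fun x : ℤ → K → ℝ => (arRow G W s θ *ᵥ state p x t) j := by
      simp only [Matrix.mulVec, dotProduct]
      exact Finset.measurable_sum _ fun b _ => (measurable_state t b).const_mul _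
    have h2 : Measurable fun x : ℤ → K → ℝ => x (t + 1) j :=
      (measurable_pi_apply j).comp (measurable_pi_apply _)
    exact ((measurable_state t a).mul (h2.sub h1)).mul (measurable_state t' a)
  have hFt : ∀ x y : ℤ → K → ℝ, (∀ τ < t' + 1, x τ = y τ) → F x = F y := by
    intro x y h
    simp only [F]
    rw [state_congr h (show t < t' + 1 by omega), state_congr h (show t' < t' + 1 by omega),
      h (t + 1) (by omega)]
  rw [← integral_past_mul_innovation hX hF hFt j]
  refine integral_congr_ae ?_
  filter_upwards [ae_equation hX] with x hx
  have h := congrFun (hx (t + 1)) j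
  rw [add_sub_cancel_right, Pi.add_apply] at h
  simp only [F]
  rw [h]
  ring

/-- The Lyapunov equation of the stationary state. -/
theorem stateMoment_lyapunov [IsProbabilityMeasure μ]
    (hX : IsStationaryGNAR μ G W s θ V X u) :
    stateMoment p μ X = companion (arMatrix G W s θ) * stateMoment p μ X
        * (companion (arMatrix G W s θ))ᵀ
      + headMatrix p K * V * (headMatrix p K)ᵀ := by
  set B := companion (arMatrix G W s θ)
  set H := headMatrix p K
  -- the entrywise expectation of a random matrix commutes with multiplication by constant matrices
  have hE : ∀ {m n m' n' : Type _} [Fintype m] [Fintype n] [Fintype m'] [Fintype n']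
      (A : Matrix m' m ℝ) (C : Matrix n n' ℝ) (Z : Ω → Matrix m n ℝ)
      (hZ : ∀ i j, Integrable (fun x => Z x i j) μ) (a : m') (b : n'),
      Integrable (fun x => (A * Z x * C) a b) μ ∧
      ∫ x, (A * Z x * C) a b ∂μ = (A * (Matrix.of fun i j => ∫ x, Z x i j ∂μ) * C) a b := by
    intro m n m' n' _ _ _ _ A C Z hZ a b
    have h1 : ∀ j, Integrable (fun x => ∑ i, A a i * Z x i j) μ := fun j =>
      integrable_finsetSum _ fun i _ => (hZ i j).const_mul _
    simp only [Matrix.mul_apply, Matrix.of_apply]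
    refine ⟨integrable_finsetSum _ fun j _ => (h1 j).mul_const _, ?_⟩
    rw [integral_finsetSum _ fun j _ => (h1 j).mul_const _]
    refine Finset.sum_congr rfl fun j _ => ?_
    rw [integral_mul_const, integral_finsetSum _ fun i _ => (hZ i j).const_mul _]
    simp only [integral_const_mul]
  set y : Ω → Fin p × K → ℝ := fun x => state p (fun t => X t x) 0 with hy
  have hyy := hE B Bᵀ (fun x => vecMulVec (y x) (y x)) fun i j =>
    (memLp_state hX.stationary 0 i).integrable_mul (memLp_state hX.stationary 0 j)
  have hyu := hE B Hᵀ (fun x => vecMulVec (y x) (u (0 + 1) x)) fun i j =>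
    (memLp_state hX.stationary 0 i).integrable_mul (hX.noise.memLp (0 + 1) j)
  have huu := hE H Hᵀ (fun x => vecMulVec (u (0 + 1) x) (u (0 + 1) x)) fun i j =>
    (hX.noise.memLp (0 + 1) i).integrable_mul (hX.noise.memLp (0 + 1) j)
  have e1 : (Matrix.of fun i j => ∫ x, vecMulVec (y x) (y x) i j ∂μ) = stateMoment p μ X := rfl
  have e2 : (Matrix.of fun i j => ∫ x, vecMulVec (y x) (u (0 + 1) x) i j ∂μ) = 0 := by
    ext i j
    exact integral_state_mul_innovation hX 0 i j
  have e3 : (Matrix.of fun i j => ∫ x, vecMulVec (u (0 + 1) x) (u (0 + 1) x) i j ∂μ) = V := by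
    ext i j
    exact integral_innovation_mul_innovation hX (0 + 1) i j
  rw [e1] at hyy
  rw [e2] at hyu
  rw [e3] at huu
  ext a b
  rw [← integral_state_mul_state hX.stationary (0 + 1) a b]
  have hstep : ∀ᵐ x ∂μ, state p (fun t => X t x) (0 + 1) a * state p (fun t => X t x) (0 + 1) b
      = (B * vecMulVec (y x) (y x) * Bᵀ) a b
        + ((B * vecMulVec (y x) (u (0 + 1) x) * Hᵀ) a b
          + (B * vecMulVec (y x) (u (0 + 1) x) * Hᵀ) b a
          + (H * vecMulVec (u (0 + 1) x) (u (0 + 1) x) * Hᵀ) a b) := by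
    filter_upwards [ae_equation hX] with x hx
    have h := state_succ (x := fun t => X t x) (u := fun t => u t x) hx 0
    rw [← Matrix.vecMulVec_apply, h, vecMulVec_affine]
    rfl
  have hadd : ∀ {f g h k : Ω → ℝ}, Integrable f μ → Integrable g μ → Integrable h μ →
      Integrable k μ → ∫ x, (f x + (g x + h x + k x)) ∂μ
        = ∫ x, f x ∂μ + (∫ x, g x ∂μ + ∫ x, h x ∂μ + ∫ x, k x ∂μ) := by
    intro f g h k hf hg hh hk
    rw [integral_add (g := fun x => g x + h x + k x) hf ((hg.add hh).add hk),
      integral_add (f := fun x => g x + h x) (hg.add hh) hk, integral_add hg hh]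
  rw [integral_congr_ae hstep, hadd (hyy a b).1 (hyu a b).1 (hyu b a).1 (huu a b).1, (hyy a b).2,
    (hyu a b).2, (hyu b a).2, (huu a b).2]
  simp

end Moments

/-! ### Laws of large numbers for a stationary GNAR process -/

section LawOfLargeNumbers

open Matrix

variable {K : Type*} [Fintype K] {Ω : Type*} [MeasurableSpace Ω] {μ : Measure Ω}
  [IsProbabilityMeasure μ]
  {G : SimpleGraph K} {W : Matrix K K ℝ} {p : ℕ} {s : Fin p → ℕ}
  {θ : CoefIndex s → ℝ} {V : Matrix K K ℝ} {X u : ℤ → Ω → K → ℝ}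

/-- Sample second moment of the innovations at the times `p + 1, …, p + n`. -/
def noiseAverage (p : ℕ) (u : ℤ → K → ℝ) (n : ℕ) : Matrix K K ℝ :=
  (n : ℝ)⁻¹ • ∑ τ ∈ Finset.range n, vecMulVec (u ((p : ℤ) + τ + 1)) (u ((p : ℤ) + τ + 1))

/-- Sample cross moment of the innovations at the times `p + 1, …, p + n` and the states that
precede them. -/
def crossAverage (p : ℕ) (x u : ℤ → K → ℝ) (n : ℕ) : Matrix (Fin p × K) K ℝ :=
  (n : ℝ)⁻¹ • ∑ τ ∈ Finset.range n, vecMulVec (state p x ((p : ℤ) + τ)) (u ((p : ℤ) + τ + 1))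

/-- Sample second moment of the states at the times `p, …, p + n - 1`. -/
def stateAverage (p : ℕ) (x : ℤ → K → ℝ) (n : ℕ) : Matrix (Fin p × K) (Fin p × K) ℝ :=
  (n : ℝ)⁻¹ • ∑ τ ∈ Finset.range n, vecMulVec (state p x ((p : ℤ) + τ)) (state p x ((p : ℤ) + τ))

/-- A single squared term is negligible in an average. -/
theorem tendstoProb_boundary (hX : IsStationaryGNAR μ G W s θ V X u) (t : ℕ → ℤ) {c : ℕ → ℝ}
    (hc : Tendsto c atTop (𝓝 0)) :
    TendstoProb μ (fun n x => c n • vecMulVec (state p (fun t => X t x) (t n))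
      (state p (fun t => X t x) (t n))) atTop 0 := by
  refine TendstoProb.matrix fun a b => ?_
  simp only [Matrix.smul_apply, vecMulVec_apply, smul_eq_mul, Matrix.zero_apply]
  have hint : ∀ t a b, Integrable (fun x => state p (fun t => X t x) t a
        * state p (fun t => X t x) t b) μ := fun t a b =>
      (memLp_state hX.stationary t a).integrable_mul (memLp_state hX.stationary t b)
  refine tendstoProb_zero_of_integral_abs (fun n => (hint (t n) a b).const_mul _) ?_
  refine squeeze_zero (fun n => integral_nonneg fun x => abs_nonneg _)
    (g := fun n => |c n| * (stateMoment p μ X a a + stateMoment p μ X b b)) (fun n => ?_)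
    (by simpa using hc.abs.mul_const (stateMoment p μ X a a + stateMoment p μ X b b))
  rw [← integral_state_mul_state hX.stationary (t n) a a,
    ← integral_state_mul_state hX.stationary (t n) b b,
    ← integral_add (hint _ _ _) (hint _ _ _), ← integral_const_mul]
  refine integral_mono ((hint (t n) a b).const_mul _).abs
    (((hint _ _ _).add (hint _ _ _)).const_mul _) fun x => ?_
  simp only [abs_mul]
  refine mul_le_mul_of_nonneg_left ?_ (abs_nonneg _)
  -- the elementary bound `|a b| ≤ a² + b²`
  rw [← abs_mul_abs_self (state p (fun t => X t x) (t n) a),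
    ← abs_mul_abs_self (state p (fun t => X t x) (t n) b)]
  nlinarith [sq_nonneg (|state p (fun t => X t x) (t n) a| - |state p (fun t => X t x) (t n) b|),
    abs_nonneg (state p (fun t => X t x) (t n) a), abs_nonneg (state p (fun t => X t x) (t n) b),
    mul_self_nonneg (state p (fun t => X t x) (t n) a),
    mul_self_nonneg |state p (fun t => X t x) (t n) a|]

theorem tendstoProb_noiseAverage (hX : IsStationaryGNAR μ G W s θ V X u) :
    TendstoProb μ (fun n x => noiseAverage p (fun t => u t x) n) atTop V := by
  refine TendstoProb.matrix fun i j => ?_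
  let Z : ℕ → Ω → ℝ := fun τ x => u ((p : ℤ) + τ + 1) x i * u ((p : ℤ) + τ + 1) x j
  have hφ : Measurable fun w : K → ℝ => w i * w j :=
    (measurable_pi_apply i).mul (measurable_pi_apply j)
  have hint : ∀ τ, Integrable (Z τ) μ := fun τ =>
    (hX.noise.memLp _ i).integrable_mul (hX.noise.memLp _ j)
  have hind : Pairwise (Function.onFun (fun f g => IndepFun f g μ) Z) := by
    intro τ τ' h
    exact (hX.noise.indep.indepFun (i := (p : ℤ) + τ + 1) (j := (p : ℤ) + τ' + 1)
      (by omega)).comp hφ hφ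
  have hid : ∀ τ, IdentDistrib (Z τ) (Z 0) μ μ := fun τ =>
    ((hX.noise.identDistrib _).trans (hX.noise.identDistrib _).symm).comp hφ
  have hlaw := strong_law_ae_real Z (hint 0) hind hid
  have hmean : ∫ x, Z 0 x ∂μ = V i j := integral_innovation_mul_innovation hX _ i j
  rw [hmean] at hlaw
  have hprob := (tendstoInMeasure_of_tendsto_ae (μ := μ) (fun n : ℕ =>
    ((integrable_finsetSum (Finset.range n) fun τ _ => hint τ).div_const
      (n : ℝ)).aestronglyMeasurable) hlaw).tendstoProb
  refine hprob.congr' (Eventually.of_forall fun n => ae_of_all _ fun x => ?_)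
  simp [noiseAverage, Z, Matrix.sum_apply, vecMulVec_apply, div_eq_inv_mul]

variable [DecidableEq K]

theorem tendstoProb_crossAverage (hX : IsStationaryGNAR μ G W s θ V X u) :
    TendstoProb μ (fun n x => crossAverage p (fun t => X t x) (fun t => u t x) n) atTop 0 := by
  refine TendstoProb.matrix fun a j => ?_
  have h := tendstoProb_average_of_orthogonal (μ := μ)
    (ξ := fun (τ : ℕ) x => state p (fun t => X t x) ((p : ℤ) + τ) a * u ((p : ℤ) + τ + 1) x j)
    (fun τ => memLp_state_mul_innovation hX _ a j)
    (fun τ => (integral_sq_state_mul_innovation hX _ a j).le)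
    (fun τ τ' hlt => integral_state_mul_innovation_orthogonal hX (by omega) a j)
  refine h.congr' (Eventually.of_forall fun n => ae_of_all _ fun x => ?_)
  simp [crossAverage, Matrix.sum_apply, vecMulVec_apply]

/-- The sample second moment of the state solves the Lyapunov equation with the sample moments of
the innovations in place of the true ones, up to a boundary term left by the telescoping sum of
`Y (t + 1) Y (t + 1)ᵀ - Y t Y tᵀ`. -/
theorem stateAverage_lyapunov {x u : ℤ → K → ℝ}
    (h : ∀ t, x t = arRow G W s θ *ᵥ state p x (t - 1) + u t) (n : ℕ) :
    stateAverage p x n - companion (arMatrix G W s θ) * stateAverage p x n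
        * (companion (arMatrix G W s θ))ᵀ
      = companion (arMatrix G W s θ) * crossAverage p x u n * (headMatrix p K)ᵀ
        + (companion (arMatrix G W s θ) * crossAverage p x u n * (headMatrix p K)ᵀ)ᵀ
        + headMatrix p K * noiseAverage p u n * (headMatrix p K)ᵀ
        + ((n : ℝ)⁻¹ • vecMulVec (state p x p) (state p x p)
          + (-(n : ℝ)⁻¹) • vecMulVec (state p x ((p : ℤ) + n)) (state p x ((p : ℤ) + n))) := by
  set B := companion (arMatrix G W s θ)
  set H := headMatrix p K
  set P : ℕ → Matrix (Fin p × K) (Fin p × K) ℝ := fun τ =>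
    vecMulVec (state p x ((p : ℤ) + τ)) (state p x ((p : ℤ) + τ)) with hP
  set Q : ℕ → Matrix (Fin p × K) K ℝ := fun τ =>
    vecMulVec (state p x ((p : ℤ) + τ)) (u ((p : ℤ) + τ + 1)) with hQ
  set N : ℕ → Matrix K K ℝ := fun τ =>
    vecMulVec (u ((p : ℤ) + τ + 1)) (u ((p : ℤ) + τ + 1)) with hN
  have hstep : ∀ τ, P (τ + 1) = B * P τ * Bᵀ + (B * Q τ * Hᵀ + (B * Q τ * Hᵀ)ᵀ
      + H * N τ * Hᵀ) := by
    intro τ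
    have h1 := state_succ h ((p : ℤ) + τ)
    have h2 : ((p : ℤ) + ((τ + 1 : ℕ) : ℤ)) = (p : ℤ) + τ + 1 := by push_cast; ring
    simp only [hP, hQ, hN, h2]
    rw [h1]
    exact vecMulVec_affine B H _ _
  have htel : ∑ τ ∈ Finset.range n, P τ + (P n - P 0) = B * (∑ τ ∈ Finset.range n, P τ) * Bᵀ
      + (B * (∑ τ ∈ Finset.range n, Q τ) * Hᵀ + (B * (∑ τ ∈ Finset.range n, Q τ) * Hᵀ)ᵀ
      + H * (∑ τ ∈ Finset.range n, N τ) * Hᵀ) := by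
    rw [← Finset.sum_range_sub, ← Finset.sum_add_distrib]
    simp only [add_sub_cancel, hstep, Finset.sum_add_distrib, Matrix.mul_sum, Matrix.sum_mul,
      Matrix.transpose_sum]
  have hP0 : P 0 = vecMulVec (state p x p) (state p x p) := by simp [hP]
  have hS : stateAverage p x n = (n : ℝ)⁻¹ • ∑ τ ∈ Finset.range n, P τ := rfl
  have hC : crossAverage p x u n = (n : ℝ)⁻¹ • ∑ τ ∈ Finset.range n, Q τ := rfl
  have hA : noiseAverage p u n = (n : ℝ)⁻¹ • ∑ τ ∈ Finset.range n, N τ := rfl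
  rw [hS, hC, hA, ← hP0]
  change _ = _ + ((n : ℝ)⁻¹ • P 0 + (-(n : ℝ)⁻¹) • P n)
  simp only [Matrix.mul_smul, Matrix.smul_mul, Matrix.transpose_smul, neg_smul]
  rw [← smul_neg, ← smul_add, ← smul_add, ← smul_add, ← smul_add, ← smul_sub]
  congr 1
  have := htel
  rw [← sub_eq_iff_eq_add'] at this
  rw [← this]
  abel

/-- The law of large numbers for the second moments of the process. The sample moment solves the
Lyapunov equation up to terms that vanish in probability, and the solution of that equation depends
continuously on its right-hand side; no ergodic theorem is needed. -/
theorem tendstoProb_stateAverage (hV : V.PosDef) (hX : IsStationaryGNAR μ G W s θ V X u) :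
    TendstoProb μ (fun n x => stateAverage p (fun t => X t x) n) atTop (stateMoment p μ X) := by
  have hlyap := stateMoment_lyapunov hX
  obtain ⟨g, hg, hgL⟩ := exists_continuous_leftInverse_lyapunov
    (tendsto_companion_pow hV (stateMoment_posSemidef hX) hlyap)
  set B := companion (arMatrix G W s θ) with hB
  set H := headMatrix p K with hH
  have hcr : Continuous fun C : Matrix (Fin p × K) K ℝ => B * C * Hᵀ + (B * C * Hᵀ)ᵀ := by
    fun_prop
  have hno : Continuous fun A : Matrix K K ℝ => H * A * Hᵀ := by fun_prop
  have hn : Tendsto (fun n : ℕ => (n : ℝ)⁻¹) atTop (𝓝 0) := tendsto_inv_atTop_nhds_zero_nat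
  have h1 := (((tendstoProb_crossAverage hX).comp_continuousAt hcr.continuousAt).add
    ((tendstoProb_noiseAverage hX).comp_continuousAt hno.continuousAt)).add
    ((tendstoProb_boundary hX (fun _ => (p : ℤ)) hn).add
      (tendstoProb_boundary hX (fun n => (p : ℤ) + n) (by simpa using hn.neg)))
  have h2 := h1.comp_continuousAt hg.continuousAt
  have hlim : B * (0 : Matrix (Fin p × K) K ℝ) * Hᵀ
      + (B * (0 : Matrix (Fin p × K) K ℝ) * Hᵀ)ᵀ + H * V * Hᵀ + (0 + 0)
      = stateMoment p μ X - B * stateMoment p μ X * Bᵀ := by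
    conv_rhs => lhs; rw [hlyap]
    simp
  rw [hlim, hgL] at h2
  refine h2.congr' (Eventually.of_forall fun n => ?_)
  filter_upwards [ae_equation hX] with x hx
  rw [← stateAverage_lyapunov hx n, hgL]

end LawOfLargeNumbers

/-! ### The estimators as continuous functions of sample moments -/

section Estimators

open Matrix

variable {K : Type*} [DecidableEq K] {p : ℕ}
  (G : SimpleGraph K) (W : Matrix K K ℝ) (s : Fin p → ℕ)

/-- The matrix that turns the state at time `t - 1` into the regressors for node `i` at
time `t`. -/
def regressorMatrix (i : K) : Matrix (CoefIndex s) (Fin p × K) ℝ :=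
  Matrix.of fun c a => arRow G W s (Pi.single c 1) i a

/-- The rows of the coefficient matrices depend linearly on the coefficients, through the transposed
regressor matrix. -/
theorem regressorMatrix_transpose_mulVec (θ : CoefIndex s → ℝ) (i : K) (a : Fin p × K) :
    ((regressorMatrix G W s i)ᵀ *ᵥ θ) a = arMatrix G W s θ a.1 i a.2 := by
  let L : (CoefIndex s → ℝ) →ₗ[ℝ] ℝ :=
    { toFun := fun θ => arMatrix G W s θ a.1 i a.2
      map_add' := fun θ θ' => by
        simp only [arMatrix, Pi.add_apply, add_smul, Finset.sum_add_distrib, Matrix.add_apply]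
        ring
      map_smul' := fun c θ => by
        simp only [arMatrix, Pi.smul_apply, smul_eq_mul, mul_smul, ← Finset.smul_sum, ← smul_add,
          Matrix.smul_apply, RingHom.id_apply] }
  have h := L.pi_apply_eq_sum_univ θ
  change arMatrix G W s θ a.1 i a.2 = _ at h
  rw [h]
  simp only [Matrix.mulVec, dotProduct, Matrix.transpose_apply, smul_eq_mul]
  refine Finset.sum_congr rfl fun c _ => ?_
  rw [mul_comm]
  congr 2
  simp only [regressorMatrix, arRow, Matrix.of_apply]
  have : (fun j => if c = j then (1 : ℝ) else 0) = Pi.single c 1 := by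
    funext j
    simp [Pi.single_apply, eq_comm]
  rw [this]
  rfl

variable [Fintype K]

theorem regressorMatrix_mulVec_state (x : ℤ → K → ℝ) (t : ℤ) (i : K) :
    regressorMatrix G W s i *ᵥ state p x (t - 1) = regressor G W s x t i := by
  funext c
  have h := sum_mul_regressor G W s (Pi.single c 1) x t i
  simp only [Pi.single_apply, mul_ite, mul_one, mul_zero, Finset.sum_ite_eq', Finset.mem_univ,
    if_true] at h
  rw [h]
  rfl

/-- The normalised Gram matrix as a function of the second moment of the state. -/
def gramMap (S : Matrix (Fin p × K) (Fin p × K) ℝ) : Matrix (CoefIndex s) (CoefIndex s) ℝ :=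
  ∑ i, regressorMatrix G W s i * S * (regressorMatrix G W s i)ᵀ

/-- The normalised product of the transposed design matrix with the stacked innovations, as a
function of the cross moment of states and innovations. -/
def scoreMap (C : Matrix (Fin p × K) K ℝ) : CoefIndex s → ℝ :=
  ∑ i, regressorMatrix G W s i *ᵥ fun a => C a i

/-- The least-squares estimator as a function of the sample moments, when `θ` are the true
coefficients. -/
def coefMap (θ : CoefIndex s → ℝ) (C : Matrix (Fin p × K) K ℝ)
    (S : Matrix (Fin p × K) (Fin p × K) ℝ) : CoefIndex s → ℝ :=
  (gramMap G W s S)⁻¹ *ᵥ (gramMap G W s S *ᵥ θ + scoreMap G W s C)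

/-- The residual covariance as a function of the sample moments, when `θ` are the true coefficients
and `η` the fitted ones: the residual at time `t + 1` is `(P θ - P η) Y t + u (t + 1)` with
`P = arRow G W s`. -/
def covMap (θ η : CoefIndex s → ℝ) (A : Matrix K K ℝ) (C : Matrix (Fin p × K) K ℝ)
    (S : Matrix (Fin p × K) (Fin p × K) ℝ) : Matrix K K ℝ :=
  let D := arRow G W s θ - arRow G W s η
  D * S * Dᵀ + (D * C + (D * C)ᵀ + A)

theorem smul_gram (x : ℤ → K → ℝ) (T : ℕ) :
    ((T - p : ℕ) : ℝ)⁻¹ • gram G W s x T = gramMap G W s (stateAverage p x (T - p)) := by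
  have h1 : gram G W s x T = ∑ i, ∑ τ : Fin (T - p),
      vecMulVec (regressor G W s x ((p : ℤ) + 1 + (τ : ℕ)) i)
        (regressor G W s x ((p : ℤ) + 1 + (τ : ℕ)) i) := by
    ext c c'
    simp only [gram, design, Matrix.mul_apply, Matrix.transpose_apply, Matrix.of_apply,
      Matrix.sum_apply, vecMulVec_apply, Fintype.sum_prod_type]
    rw [Finset.sum_comm]
  rw [h1, gramMap, Finset.smul_sum]
  refine Finset.sum_congr rfl fun i _ => ?_
  rw [stateAverage, Matrix.mul_smul, Matrix.smul_mul, Matrix.mul_sum, Matrix.sum_mul,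
    ← Fin.sum_univ_eq_sum_range (fun τ => regressorMatrix G W s i
      * vecMulVec (state p x ((p : ℤ) + τ)) (state p x ((p : ℤ) + τ))
      * (regressorMatrix G W s i)ᵀ)]
  congr 1
  refine Finset.sum_congr rfl fun τ _ => ?_
  rw [← regressorMatrix_mulVec_state, Matrix.mul_vecMulVec, Matrix.vecMulVec_mul,
    Matrix.vecMul_transpose]
  have : (p : ℤ) + 1 + (τ : ℕ) - 1 = (p : ℤ) + (τ : ℕ) := by ring
  rw [this]

variable {G W s} {θ : CoefIndex s → ℝ} {x u : ℤ → K → ℝ}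

theorem response_eq (h : ∀ t, x t = arRow G W s θ *ᵥ state p x (t - 1) + u t) (T : ℕ) :
    response p x T = design G W s x T *ᵥ θ + fun a => u ((p : ℤ) + (a.1 : ℕ) + 1) a.2 := by
  funext a
  have h1 := congrFun (h ((p : ℤ) + 1 + (a.1 : ℕ))) a.2
  rw [Pi.add_apply, ← sum_mul_regressor] at h1
  have h2 : (p : ℤ) + (a.1 : ℕ) + 1 = (p : ℤ) + 1 + (a.1 : ℕ) := add_right_comm _ _ _
  rw [response, h1, Pi.add_apply, h2]
  rfl

theorem smul_design_transpose_mulVec_noise (x u : ℤ → K → ℝ) (T : ℕ) :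
    ((T - p : ℕ) : ℝ)⁻¹ • ((design G W s x T)ᵀ *ᵥ
        fun a => u ((p : ℤ) + (a.1 : ℕ) + 1) a.2)
      = scoreMap G W s (crossAverage p x u (T - p)) := by
  funext c
  simp only [Pi.smul_apply, smul_eq_mul, scoreMap, Finset.sum_apply, Matrix.mulVec, dotProduct,
    crossAverage, Matrix.smul_apply, Matrix.sum_apply, vecMulVec_apply, Matrix.transpose_apply,
    Fintype.sum_prod_type (γ := ℝ) (α₁ := Fin (T - p)), design, Matrix.of_apply]
  rw [Finset.sum_comm, Finset.mul_sum]
  refine Finset.sum_congr rfl fun i _ => ?_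
  simp only [Finset.mul_sum]
  rw [Finset.sum_comm (s := (Finset.univ : Finset (Fin p × K))),
    ← Fin.sum_univ_eq_sum_range (fun τ => ∑ a, regressorMatrix G W s i c a *
      (((T - p : ℕ) : ℝ)⁻¹ * (state p x ((p : ℤ) + τ) a * u ((p : ℤ) + τ + 1) i)))]
  refine Finset.sum_congr rfl fun τ _ => ?_
  rw [← regressorMatrix_mulVec_state]
  have : (p : ℤ) + 1 + (τ : ℕ) - 1 = (p : ℤ) + (τ : ℕ) := by ring
  rw [this, Matrix.mulVec, dotProduct, Finset.sum_mul, Finset.mul_sum]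
  refine Finset.sum_congr rfl fun a _ => ?_
  ring

/-- This holds for singular matrices too, where both sides are zero by convention. -/
theorem inv_smul_of_ne_zero {n : Type*} [Fintype n] [DecidableEq n] (A : Matrix n n ℝ) {c : ℝ}
    (hc : c ≠ 0) : (c • A)⁻¹ = c⁻¹ • A⁻¹ := by
  by_cases hA : IsUnit A.det
  · exact Matrix.inv_smul' A (Units.mk0 c hc) hA
  · have hcA : ¬ IsUnit (c • A).det := by
      rw [Matrix.det_smul]
      exact fun h => hA (isUnit_of_mul_isUnit_right h)
    rw [Matrix.nonsing_inv_apply_not_isUnit _ hA, Matrix.nonsing_inv_apply_not_isUnit _ hcA,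
      smul_zero]

theorem coefEst_eq (h : ∀ t, x t = arRow G W s θ *ᵥ state p x (t - 1) + u t) {T : ℕ}
    (hT : p < T) :
    coefEst G W s x T = coefMap G W s θ (crossAverage p x u (T - p)) (stateAverage p x (T - p)) := by
  have hn : (((T - p : ℕ) : ℝ))⁻¹ ≠ 0 :=
    inv_ne_zero (Nat.cast_ne_zero.2 (Nat.sub_ne_zero_of_lt hT))
  rw [coefMap, ← smul_gram, ← smul_design_transpose_mulVec_noise, inv_smul_of_ne_zero _ hn,
    Matrix.smul_mulVec, Matrix.smul_mulVec, ← smul_add, Matrix.mulVec_smul, smul_smul,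
    inv_mul_cancel₀ hn, one_smul, coefEst, response_eq h T, Matrix.mulVec_add,
    Matrix.mulVec_mulVec]
  rfl

theorem covEst_eq (h : ∀ t, x t = arRow G W s θ *ᵥ state p x (t - 1) + u t) (T : ℕ) :
    covEst G W s x T = covMap G W s θ (coefEst G W s x T) (noiseAverage p u (T - p))
      (crossAverage p x u (T - p)) (stateAverage p x (T - p)) := by
  set D := arRow G W s θ - arRow G W s (coefEst G W s x T) with hD
  set r : ℕ → K → ℝ := fun τ =>
    D *ᵥ state p x ((p : ℤ) + τ) + (1 : Matrix K K ℝ) *ᵥ u ((p : ℤ) + τ + 1) with hr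
  have hres : ∀ (τ : Fin (T - p)) (i : K), residual G W s x T (τ, i) = r τ i := by
    intro τ i
    have hp : (p : ℤ) + 1 + (τ : ℕ) - 1 = (p : ℤ) + (τ : ℕ) := by ring
    have hdes : ∀ η : CoefIndex s → ℝ, (design G W s x T *ᵥ η) (τ, i)
        = (arRow G W s η *ᵥ state p x ((p : ℤ) + (τ : ℕ))) i := by
      intro η
      rw [← hp, ← sum_mul_regressor]
      rfl
    rw [residual, response_eq h T, Pi.sub_apply, Pi.add_apply, hdes, hdes, hr, hD]
    simp only [Matrix.sub_mulVec, Matrix.one_mulVec, Pi.add_apply, Pi.sub_apply]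
    ring
  have hcov : covEst G W s x T
      = ((T - p : ℕ) : ℝ)⁻¹ • ∑ τ ∈ Finset.range (T - p), vecMulVec (r τ) (r τ) := by
    ext i j
    rw [← Fin.sum_univ_eq_sum_range (fun τ => vecMulVec (r τ) (r τ))]
    simp only [covEst, Matrix.of_apply, hres, Matrix.smul_apply, Matrix.sum_apply,
      vecMulVec_apply, smul_eq_mul]
  rw [hcov]
  simp only [hr, vecMulVec_affine, covMap, ← hD, noiseAverage, crossAverage, stateAverage,
    Matrix.transpose_one, Matrix.mul_one, Matrix.one_mul, Finset.sum_add_distrib,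
    ← Matrix.mul_sum, ← Matrix.sum_mul, ← Matrix.transpose_sum, smul_add, Matrix.mul_smul,
    Matrix.smul_mul, Matrix.transpose_smul]

end Estimators

/-! ### Continuity and invertibility at the limit -/

section Limit

open Matrix

variable {K : Type*} {p : ℕ}
  {G : SimpleGraph K} {W : Matrix K K ℝ} {s : Fin p → ℕ}

open scoped ComplexOrder in
theorem continuousAt_sqCoherence {M : Matrix K K ℂ} (hM : M.PosDef) (i j : K) :
    ContinuousAt (fun M : Matrix K K ℂ => sqCoherence M i j) M := by
  have hpos : ∀ i, 0 < (M i i).re := fun i => (Complex.lt_def.1 (hM.diag_pos (i := i))).1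
  have hc : ∀ i j, Continuous fun M : Matrix K K ℂ => M i j := fun i j =>
    continuous_id.matrix_elem i j
  exact ContinuousAt.div ((hc i j).norm.pow 2).continuousAt
    ((Complex.continuous_re.comp (hc i i)).mul
      (Complex.continuous_re.comp (hc j j))).continuousAt
    (mul_pos (hpos i) (hpos j)).ne'

variable [DecidableEq K]

/-- The coefficient matrices determine the coefficients: the identity and the matrices `W ⊙ A_r`
have pairwise disjoint supports, and none of them vanishes. -/
theorem eq_zero_of_arMatrix_eq_zero [Nonempty K]
    (hW : ∀ (k : Fin p) (r : Fin (s k)), nbhdMatrix G W ((r : ℕ) + 1) ≠ 0)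
    {θ : CoefIndex s → ℝ} (h : ∀ k, arMatrix G W s θ k = 0) : θ = 0 := by
  have hentry : ∀ (r : ℕ) (i j : K), G.dist i j ≠ r + 1 → nbhdMatrix G W (r + 1) i j = 0 := by
    intro r i j hij
    simp [nbhdMatrix, stageAdj, hij]
  funext c
  rcases c with k | ⟨k, r⟩
  · obtain ⟨i⟩ := ‹Nonempty K›
    have h0 := congrFun (congrFun (h k) i) i
    simp only [arMatrix, Matrix.add_apply, Matrix.smul_apply, Matrix.one_apply_eq, smul_eq_mul,
      mul_one, Matrix.sum_apply, Matrix.zero_apply] at h0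
    rw [Finset.sum_eq_zero fun r _ => by rw [hentry _ _ _ (by simp), mul_zero], add_zero] at h0
    exact h0
  · have hne : ∃ i j, nbhdMatrix G W ((r : ℕ) + 1) i j ≠ 0 := by
      by_contra! hcon
      exact hW k r (Matrix.ext hcon)
    obtain ⟨i, j, hij⟩ := hne
    have hdist : G.dist i j = (r : ℕ) + 1 := by
      by_contra hd
      exact hij (hentry _ _ _ hd)
    have hijne : i ≠ j := by
      rintro rfl
      simp at hdist
    have h0 := congrFun (congrFun (h k) i) j
    simp only [arMatrix, Matrix.add_apply, Matrix.smul_apply, Matrix.one_apply_ne hijne,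
      smul_eq_mul, mul_zero, zero_add, Matrix.sum_apply, Matrix.zero_apply] at h0
    rw [Finset.sum_eq_single r, mul_eq_zero] at h0
    · exact h0.resolve_right hij
    · intro r' _ hr'
      rw [hentry _ _ _ (fun hd => hr' (Fin.ext (by omega))), mul_zero]
    · simp

theorem continuous_arMatrix (k : Fin p) :
    Continuous fun θ : CoefIndex s → ℝ => arMatrix G W s θ k := by
  unfold arMatrix
  fun_prop

theorem continuous_arRow : Continuous fun θ : CoefIndex s → ℝ => arRow G W s θ :=
  continuous_matrix fun i a => (continuous_arMatrix a.1).matrix_elem i a.2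

theorem continuous_transfer (ω : ℝ) :
    Continuous fun θ : CoefIndex s → ℝ => transfer G W s θ ω := by
  unfold transfer
  refine continuous_const.sub (continuous_finsetSum _ fun k _ => ?_)
  have h : Continuous fun θ : CoefIndex s → ℝ => (arMatrix G W s θ k).map Complex.ofReal :=
    (continuous_arMatrix k).matrix_map Complex.continuous_ofReal
  exact Continuous.const_smul (M := ℂ) h _

variable [Fintype K]

theorem gramMap_posDef [Nonempty K]
    (hW : ∀ (k : Fin p) (r : Fin (s k)), nbhdMatrix G W ((r : ℕ) + 1) ≠ 0)
    {S : Matrix (Fin p × K) (Fin p × K) ℝ} (hS : S.PosDef) : (gramMap G W s S).PosDef := by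
  have hpsd : (gramMap G W s S).PosSemidef := by
    refine Matrix.posSemidef_sum _ fun i _ => ?_
    have := hS.posSemidef.mul_mul_conjTranspose_same (regressorMatrix G W s i)
    rwa [Matrix.conjTranspose_eq_transpose_of_trivial] at this
  refine Matrix.PosDef.of_dotProduct_mulVec_pos hpsd.1 fun v hv => ?_
  have hquad : star v ⬝ᵥ (gramMap G W s S *ᵥ v)
      = ∑ i, ((regressorMatrix G W s i)ᵀ *ᵥ v) ⬝ᵥ (S *ᵥ ((regressorMatrix G W s i)ᵀ *ᵥ v)) := by
    rw [gramMap, Matrix.sum_mulVec, dotProduct_sum, star_trivial]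
    refine Finset.sum_congr rfl fun i _ => ?_
    rw [← Matrix.mulVec_mulVec, ← Matrix.mulVec_mulVec, Matrix.dotProduct_mulVec v,
      ← Matrix.mulVec_transpose]
  rw [hquad]
  have hne : ∃ i, (regressorMatrix G W s i)ᵀ *ᵥ v ≠ 0 := by
    by_contra! hcon
    refine hv (eq_zero_of_arMatrix_eq_zero hW fun k => ?_)
    ext i j
    rw [← regressorMatrix_transpose_mulVec G W s v i (k, j), hcon]
    rfl
  obtain ⟨i, hi⟩ := hne
  refine Finset.sum_pos' (fun i _ => ?_) ⟨i, Finset.mem_univ i, ?_⟩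
  · simpa using hS.posSemidef.dotProduct_mulVec_nonneg ((regressorMatrix G W s i)ᵀ *ᵥ v)
  · simpa using hS.dotProduct_mulVec_pos hi

theorem continuous_gramMap : Continuous (gramMap G W s) := by
  unfold gramMap
  fun_prop

theorem continuous_scoreMap : Continuous (scoreMap G W s) := by
  unfold scoreMap
  refine continuous_finsetSum _ fun i _ => continuous_const.matrix_mulVec ?_
  exact continuous_pi fun a => continuous_id.matrix_elem a i

theorem continuousAt_matrix_inv_of_isUnit {n 𝕜 : Type*} [Fintype n] [DecidableEq n]
    [NormedField 𝕜] {A : Matrix n n 𝕜} (hA : IsUnit A.det) :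
    ContinuousAt (fun M : Matrix n n 𝕜 => M⁻¹) A := by
  refine continuousAt_matrix_inv A ?_
  rw [Ring.inverse_eq_inv']
  exact continuousAt_inv₀ hA.ne_zero

theorem continuousAt_coefMap {θ : CoefIndex s → ℝ} {S : Matrix (Fin p × K) (Fin p × K) ℝ}
    (hS : IsUnit (gramMap G W s S).det) (C : Matrix (Fin p × K) K ℝ) :
    ContinuousAt (fun e : Matrix (Fin p × K) K ℝ × Matrix (Fin p × K) (Fin p × K) ℝ =>
      coefMap G W s θ e.1 e.2) (C, S) := by
  have hg : ContinuousAt (fun e : Matrix (Fin p × K) K ℝ × Matrix (Fin p × K) (Fin p × K) ℝ =>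
      gramMap G W s e.2) (C, S) := (continuous_gramMap.comp continuous_snd).continuousAt
  have hi : ContinuousAt (fun e : Matrix (Fin p × K) K ℝ × Matrix (Fin p × K) (Fin p × K) ℝ =>
      (gramMap G W s e.2)⁻¹) (C, S) :=
    ContinuousAt.comp (g := fun M : Matrix (CoefIndex s) (CoefIndex s) ℝ => M⁻¹)
      (continuousAt_matrix_inv_of_isUnit hS) hg
  have hr : ContinuousAt (fun e : Matrix (Fin p × K) K ℝ × Matrix (Fin p × K) (Fin p × K) ℝ =>
      gramMap G W s e.2 *ᵥ θ + scoreMap G W s e.1) (C, S) :=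
    (((continuous_gramMap.comp continuous_snd).matrix_mulVec continuous_const).add
      (continuous_scoreMap.comp continuous_fst)).continuousAt
  have hm : Continuous fun q : Matrix (CoefIndex s) (CoefIndex s) ℝ × (CoefIndex s → ℝ) =>
      q.1 *ᵥ q.2 := continuous_fst.matrix_mulVec continuous_snd
  exact ContinuousAt.comp (g := fun q : Matrix (CoefIndex s) (CoefIndex s) ℝ
    × (CoefIndex s → ℝ) => q.1 *ᵥ q.2) hm.continuousAt (hi.prodMk hr)

theorem continuousAt_spectrum {θ : CoefIndex s → ℝ} {V : Matrix K K ℝ} {ω : ℝ}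
    (h : IsUnit (transfer G W s θ ω).det) :
    ContinuousAt (fun q : (CoefIndex s → ℝ) × Matrix K K ℝ => spectrum G W s q.1 q.2 ω) (θ, V) := by
  have hi : Tendsto (fun q : (CoefIndex s → ℝ) × Matrix K K ℝ => (transfer G W s q.1 ω)⁻¹)
      (𝓝 (θ, V)) (𝓝 (transfer G W s θ ω)⁻¹) :=
    (continuousAt_matrix_inv_of_isUnit h).tendsto.comp
      (((continuous_transfer ω).comp continuous_fst).tendsto (θ, V))
  have hV : Tendsto (fun q : (CoefIndex s → ℝ) × Matrix K K ℝ => q.2.map Complex.ofReal)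
      (𝓝 (θ, V)) (𝓝 (V.map Complex.ofReal)) :=
    (continuous_snd.matrix_map Complex.continuous_ofReal).tendsto (θ, V)
  have hH : Tendsto (fun q : (CoefIndex s → ℝ) × Matrix K K ℝ =>
      ((transfer G W s q.1 ω)⁻¹).conjTranspose)
      (𝓝 (θ, V)) (𝓝 ((transfer G W s θ ω)⁻¹).conjTranspose) :=
    (continuous_id.matrix_conjTranspose.tendsto _).comp hi
  exact (hi.mul hV).mul hH

theorem isUnit_det_transfer {θ : CoefIndex s → ℝ}
    (hB : Tendsto (fun j => companion (arMatrix G W s θ) ^ j) atTop (𝓝 0)) (ω : ℝ) :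
    IsUnit (transfer G W s θ ω).det := by
  rw [isUnit_iff_ne_zero]
  intro h0
  obtain ⟨w, hw, hw0⟩ := Matrix.exists_mulVec_eq_zero_iff.2 h0
  set z : ℂ := Complex.exp (-(Complex.I * 2 * Real.pi * ω)) with hz
  have hnorm : ‖z‖ = 1 := by
    have : -(Complex.I * 2 * Real.pi * ω) = ((-(2 * Real.pi * ω) : ℝ) : ℂ) * Complex.I := by
      push_cast
      ring
    rw [hz, this, Complex.norm_exp_ofReal_mul_I]
  refine hw (transfer_kernel_eq_zero hB hnorm ?_)
  rw [← hw0, transfer]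
  congr 2
  refine Finset.sum_congr rfl fun k _ => ?_
  rw [hz, ← Complex.exp_nat_mul]
  congr 2
  push_cast
  ring

open scoped ComplexOrder

theorem map_ofReal_posDef {V : Matrix K K ℝ} (hV : V.PosDef) :
    (V.map Complex.ofReal).PosDef := by
  obtain ⟨L, rfl, hL⟩ := exists_transpose_mul_self_of_posDef hV
  have hmul : (Lᵀ * L).map Complex.ofReal
      = (L.map Complex.ofReal)ᴴ * L.map Complex.ofReal := by
    rw [show (Lᵀ * L).map Complex.ofReal = Lᵀ.map Complex.ofReal * L.map Complex.ofReal from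
      Matrix.map_mul (f := Complex.ofRealHom)]
    congr 1
    ext i j
    simp
  have hdet : IsUnit (L.map Complex.ofReal).det := by
    have := hL.map Complex.ofRealHom
    rwa [RingHom.map_det] at this
  rw [hmul]
  exact Matrix.PosDef.conjTranspose_mul_self _
    (Matrix.mulVec_injective_of_isUnit ((Matrix.isUnit_iff_isUnit_det _).2 hdet))

theorem spectrum_posDef {θ : CoefIndex s → ℝ} {V : Matrix K K ℝ} (hV : V.PosDef) {ω : ℝ}
    (h : IsUnit (transfer G W s θ ω).det) : (spectrum G W s θ V ω).PosDef := by
  refine (map_ofReal_posDef hV).mul_mul_conjTranspose_same ?_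
  refine Matrix.vecMul_injective_of_isUnit ?_
  rw [Matrix.isUnit_iff_isUnit_det]
  exact Matrix.isUnit_nonsing_inv_det _ h

theorem isUnit_det_spectrum {θ : CoefIndex s → ℝ} {V : Matrix K K ℝ} (hV : V.PosDef) {ω : ℝ}
    (h : IsUnit (transfer G W s θ ω).det) : IsUnit (spectrum G W s θ V ω).det :=
  (Matrix.isUnit_iff_isUnit_det _).1 (spectrum_posDef hV h).isUnit

theorem continuousAt_sqCoherence_spectrum {θ : CoefIndex s → ℝ} {V : Matrix K K ℝ}
    (hV : V.PosDef) {ω : ℝ} (h : IsUnit (transfer G W s θ ω).det) (i j : K) :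
    ContinuousAt (fun M : Matrix K K ℂ => sqCoherence M i j) (spectrum G W s θ V ω) :=
  continuousAt_sqCoherence (spectrum_posDef hV h) i j

theorem continuousAt_sqCoherence_inv_spectrum {θ : CoefIndex s → ℝ} {V : Matrix K K ℝ}
    (hV : V.PosDef) {ω : ℝ} (h : IsUnit (transfer G W s θ ω).det) (i j : K) :
    ContinuousAt (fun M : Matrix K K ℂ => sqCoherence M i j) (spectrum G W s θ V ω)⁻¹ :=
  continuousAt_sqCoherence (spectrum_posDef hV h).inv i j

end Limit

/-! ### Consistency -/

section Consistency

open Matrix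

variable {K : Type*} [Fintype K] [DecidableEq K] {Ω : Type*} [MeasurableSpace Ω]
  {μ : Measure Ω}
  {G : SimpleGraph K} {W : Matrix K K ℝ} {p : ℕ} {s : Fin p → ℕ}
  {θ : CoefIndex s → ℝ} {V : Matrix K K ℝ} {X u : ℤ → Ω → K → ℝ}

theorem ae_forall_coefEst_covEst (hX : IsStationaryGNAR μ G W s θ V X u) :
    ∀ᵐ x ∂μ, ∀ T, p < T →
      coefEst G W s (fun t => X t x) T = coefMap G W s θ
        (crossAverage p (fun t => X t x) (fun t => u t x) (T - p))
        (stateAverage p (fun t => X t x) (T - p)) ∧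
      covEst G W s (fun t => X t x) T = covMap G W s θ (coefEst G W s (fun t => X t x) T)
        (noiseAverage p (fun t => u t x) (T - p))
        (crossAverage p (fun t => X t x) (fun t => u t x) (T - p))
        (stateAverage p (fun t => X t x) (T - p)) := by
  filter_upwards [ae_equation hX] with x hx T hT
  exact ⟨coefEst_eq hx hT, covEst_eq hx T⟩

variable [Nonempty K] [IsProbabilityMeasure μ]

/-- Joint consistency of the normalised Gram matrix, the least-squares estimator and the residual
covariance. -/
theorem tendstoProb_estimators
    (hW : ∀ (k : Fin p) (r : Fin (s k)), nbhdMatrix G W ((r : ℕ) + 1) ≠ 0)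
    (hV : V.PosDef) (hX : IsStationaryGNAR μ G W s θ V X u) :
    TendstoProb μ (fun (T : ℕ) x => (((T - p : ℕ) : ℝ)⁻¹ • gram G W s (fun t => X t x) T,
        (coefEst G W s (fun t => X t x) T, covEst G W s (fun t => X t x) T))) atTop
      (gramMap G W s (stateMoment p μ X), (θ, V)) := by
  have hΓ : (stateMoment p μ X).PosDef :=
    lyapunov_posDef hV (stateMoment_posSemidef hX) (stateMoment_lyapunov hX)
  have hgram : IsUnit (gramMap G W s (stateMoment p μ X)).det :=
    (Matrix.isUnit_iff_isUnit_det _).1 (gramMap_posDef hW hΓ).isUnit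
  have hsub : Tendsto (fun T : ℕ => T - p) atTop atTop := tendsto_sub_atTop_nat p
  have hS := (tendstoProb_stateAverage hV hX).comp_tendsto hsub
  have hC := (tendstoProb_crossAverage hX).comp_tendsto hsub
  have hA := (tendstoProb_noiseAverage (p := p) hX).comp_tendsto hsub
  have hcoef := (hC.prodMk hS).comp_continuousAt (continuousAt_coefMap (θ := θ) hgram 0)
  have hlim : coefMap G W s θ 0 (stateMoment p μ X) = θ := by
    have h0 : scoreMap G W s (0 : Matrix (Fin p × K) K ℝ) = 0 := by
      refine Finset.sum_eq_zero fun i _ => ?_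
      exact Matrix.mulVec_zero _
    rw [coefMap, h0, add_zero, Matrix.mulVec_mulVec, Matrix.nonsing_inv_mul _ hgram,
      Matrix.one_mulVec]
  rw [hlim] at hcoef
  have hcovc : Continuous fun q : ((CoefIndex s → ℝ) × Matrix K K ℝ)
      × (Matrix (Fin p × K) K ℝ × Matrix (Fin p × K) (Fin p × K) ℝ) =>
      covMap G W s θ q.1.1 q.1.2 q.2.1 q.2.2 := by
    have hD : Continuous fun q : ((CoefIndex s → ℝ) × Matrix K K ℝ)
        × (Matrix (Fin p × K) K ℝ × Matrix (Fin p × K) (Fin p × K) ℝ) =>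
        arRow G W s θ - arRow G W s q.1.1 :=
      continuous_const.sub (continuous_arRow.comp (continuous_fst.comp continuous_fst))
    unfold covMap
    fun_prop
  have hcov := ((hcoef.prodMk hA).prodMk (hC.prodMk hS)).comp_continuousAt hcovc.continuousAt
  have hlim' : covMap G W s θ θ V 0 (stateMoment p μ X) = V := by
    simp [covMap]
  simp only [hlim'] at hcov
  have hall := (hS.comp_continuousAt (g := gramMap G W s)
    continuous_gramMap.continuousAt).prodMk (hcoef.prodMk hcov)
  refine hall.congr' ?_
  -- for `T ≤ p` the regression has no rows, and normalising by `T - p = 0` loses the estimator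
  filter_upwards [eventually_gt_atTop p] with T hT
  filter_upwards [ae_forall_coefEst_covEst hX] with x hx
  obtain ⟨h1, h2⟩ := hx T hT
  rw [h2, h1, smul_gram]

end Consistency

end GNAR

end

theorem mainTheorem2 {K : Type*} [Fintype K] [DecidableEq K] [Nonempty K]
    {Ω : Type*} [MeasurableSpace Ω] (μ : Measure Ω) [IsProbabilityMeasure μ]
    (G : SimpleGraph K) (W : Matrix K K ℝ) {p : ℕ} (s : Fin p → ℕ)
    (hW : ∀ (k : Fin p) (r : Fin (s k)), GNAR.nbhdMatrix G W ((r : ℕ) + 1) ≠ 0)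
    (θ : GNAR.CoefIndex s → ℝ) (V : Matrix K K ℝ) (hV : V.PosDef)
    (X u : ℤ → Ω → K → ℝ) (hX : GNAR.IsStationaryGNAR μ G W s θ V X u)
    (ω : ℝ) (hω : ω ∈ Set.Ioc (0 : ℝ) (1 / 2)) :
    (IsUnit (GNAR.transfer G W s θ ω).det ∧ IsUnit (GNAR.spectrum G W s θ V ω).det) ∧
    Tendsto (fun T : ℕ => μ {x | ¬ GNAR.EstimatorsDefined G W s (fun t => X t x) T ω})
      atTop (𝓝 0) ∧
    ∀ i j : K,
      TendstoInMeasure μ (fun (T : ℕ) x => GNAR.spectrumEst G W s (fun t => X t x) T ω i j)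
        atTop (fun _ => GNAR.spectrum G W s θ V ω i j) ∧
      TendstoInMeasure μ (fun (T : ℕ) x => (GNAR.spectrumEst G W s (fun t => X t x) T ω)⁻¹ i j)
        atTop (fun _ => (GNAR.spectrum G W s θ V ω)⁻¹ i j) ∧
      TendstoInMeasure μ
        (fun (T : ℕ) x => GNAR.sqCoherence (GNAR.spectrumEst G W s (fun t => X t x) T ω) i j)
        atTop (fun _ => GNAR.sqCoherence (GNAR.spectrum G W s θ V ω) i j) ∧
      TendstoInMeasure μ
        (fun (T : ℕ) x => GNAR.sqCoherence (GNAR.spectrumEst G W s (fun t => X t x) T ω)⁻¹ i j)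
        atTop (fun _ => GNAR.sqCoherence (GNAR.spectrum G W s θ V ω)⁻¹ i j) := by
  have hpsd := GNAR.stateMoment_posSemidef hX
  have hlyap := GNAR.stateMoment_lyapunov hX
  have hgram : IsUnit (GNAR.gramMap G W s (GNAR.stateMoment p μ X)).det :=
    (Matrix.isUnit_iff_isUnit_det _).1
      (GNAR.gramMap_posDef hW (GNAR.lyapunov_posDef hV hpsd hlyap)).isUnit
  have hU : IsUnit (GNAR.transfer G W s θ ω).det :=
    GNAR.isUnit_det_transfer (GNAR.tendsto_companion_pow hV hpsd hlyap) ω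
  have hfdet : IsUnit (GNAR.spectrum G W s θ V ω).det := GNAR.isUnit_det_spectrum hV hU
  have hest := GNAR.tendstoProb_estimators hW hV hX
  have hspec := hest.comp_continuousAt (g := fun q => GNAR.spectrum G W s q.2.1 q.2.2 ω)
    (ContinuousAt.comp (g := fun q : (GNAR.CoefIndex s → ℝ) × Matrix K K ℝ =>
      GNAR.spectrum G W s q.1 q.2 ω) (GNAR.continuousAt_spectrum hU) continuousAt_snd)
  have hinv := hspec.comp_continuousAt (g := fun M => M⁻¹)
    (GNAR.continuousAt_matrix_inv_of_isUnit hfdet)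
  refine ⟨⟨hU, hfdet⟩, ?_, fun i j => ⟨?_, ?_, ?_, ?_⟩⟩
  · -- invertibility is an open condition, so it holds near the limit of the estimators
    have hgood : GNAR.TendstoProb μ (fun (T : ℕ) x => (
        ((((T - p : ℕ) : ℝ)⁻¹ • GNAR.gram G W s (fun t => X t x) T).det,
        (GNAR.transfer G W s (GNAR.coefEst G W s (fun t => X t x) T) ω).det),
        (GNAR.spectrumEst G W s (fun t => X t x) T ω).det)) atTop
        (((GNAR.gramMap G W s (GNAR.stateMoment p μ X)).det, (GNAR.transfer G W s θ ω).det),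
        (GNAR.spectrum G W s θ V ω).det) :=
      ((hest.comp_continuousAt (g := fun q => q.1.det)
          continuous_fst.matrix_det.continuousAt).prodMk
        (hest.comp_continuousAt (g := fun q => (GNAR.transfer G W s q.2.1 ω).det)
          ((GNAR.continuous_transfer ω).comp
            (continuous_fst.comp continuous_snd)).matrix_det.continuousAt)).prodMk
        (hspec.comp_continuousAt (g := fun M => M.det) continuous_id.matrix_det.continuousAt)
    have hopen := prod_mem_nhds (prod_mem_nhds (isOpen_ne.mem_nhds hgram.ne_zero)
      (isOpen_ne.mem_nhds hU.ne_zero)) (isOpen_ne.mem_nhds hfdet.ne_zero)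
    refine tendsto_of_tendsto_of_tendsto_of_le_of_le tendsto_const_nhds (hgood _ hopen)
      (fun _ => zero_le) fun T => measure_mono fun x hx hmem => hx ?_
    obtain ⟨⟨h1, h2⟩, h3⟩ := hmem
    refine ⟨?_, isUnit_iff_ne_zero.2 h2, isUnit_iff_ne_zero.2 h3⟩
    change Matrix.det _ ≠ 0 at h1
    rw [Matrix.det_smul] at h1
    exact isUnit_iff_ne_zero.2 (right_ne_zero_of_mul h1)
  · exact (hspec.comp_continuousAt (g := fun M => M i j)
      (continuous_id.matrix_elem i j).continuousAt).tendstoInMeasure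
  · exact (hinv.comp_continuousAt (g := fun M => M i j)
      (continuous_id.matrix_elem i j).continuousAt).tendstoInMeasure
  · exact (hspec.comp_continuousAt (g := fun M => GNAR.sqCoherence M i j)
      (GNAR.continuousAt_sqCoherence_spectrum hV hU i j)).tendstoInMeasure
  · exact (hinv.comp_continuousAt (g := fun M => GNAR.sqCoherence M i j)
      (GNAR.continuousAt_sqCoherence_inv_spectrum hV hU i j)).tendstoInMeasure
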